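/- **Setting.** Let $\mathcal M$ be a Markov decision process with measurable state and action spaces $\mathcal S,\mathcal A$, transition kernel $p$, measurable reward $r$ with $|r|\le R_{\max}$, initial distribution $\rho_0$, discount factor $\gamma\in[0,1]$ and finite horizon $T$. Let $\Theta\subseteq\mathbb R^{d_\Theta}$ be open and let $\pi_\theta(a|s)$, $\theta\in\Theta$, be a measurable family of policy densities with respect to a $\sigma$-finite reference measure on $\mathcal A$. Let $p_\theta$ be the induced distribution of trajectories $\tau=(s_1,a_1,\dots,s_T,a_T)$, let $R(\tau)=\sum_{t=1}^T\gamma^{t-1}r(s_t,a_t)$ and $J(\theta)=\mathbb E_{\tau\sim p_\theta}[R(\tau)]$. Let $\mathbf g_\theta(\tau)$ be either the REINFORCE estimator $R(\tau)\sum_{t=1}^T\nabla_\theta\log\pi_\theta(a_t|s_t)$ or the GPOMDP estimator $\sum_{t=1}^T\gamma^{t-1}r(s_t,a_t)\sum_{l=1}^t\nabla_\theta\log\pi_\theta(a_l|s_l)$. **Assumptions.** (1) There are $L_1,L_2>0$ such that for all $\theta\in\Theta$, $s$, $a$: $\pi_\theta(a|s)>0$, $\log\pi_\theta(a|s)$ is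 twice differentiable in $\theta$, $\|\nabla\log\pi_\theta(a|s)\|_2\le L_1$ and $\|\nabla^2\log\pi_\theta(a|s)\|_2\le L_2$. (2) $D\ge1$ satisfies $\sup_{\theta_1,\theta_2\in\Theta}\chi^2(p_{\theta_1}\|p_{\theta_2})\le D-1$, where $\chi^2(P\|Q)=\int (dP/dQ)^2\,dQ-1$ if $P\ll Q$, and $\chi^2(P\|Q)=\infty$ otherwise. **Data.** Let $k,\omega\ge1$, $\omega_k=\min\{\omega,k\}$, $k_0=k-\omega_k+1$. Let $\mathcal H_k=(\theta_1,(\tau_{1,j})_{j=1}^N,\dots,\theta_k,(\tau_{k,j})_{j=1}^N)$ be random, with $\theta_i\in\Theta$, such that for every $i\le k$, conditionally on $\theta_1,(\tau_{1,j})_j,\dots,\theta_{i-1},(\tau_{i-1,j})_j,\theta_i$, the trajectories $\tau_{i,1},\dots,\tau_{i,N}$ are independent with distribution $p_{\theta_i}$ (each $\theta_i$ may depend on the past in any way). For coefficients $\alpha_{i,k},\lambda_{i,k}$ let $$\widehat\nabla^{\mathrm{MPM}}_{\omega_k}J(\theta)=\sum_{i=k_0}^k\frac1N\sum_{j=1}^N\frac{\alpha_{i,k}\,\mathbf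 g_\theta(\tau_{i,j})}{(1-\lambda_{i,k})\frac{p_{\theta_i}(\tau_{i,j})}{p_\theta(\tau_{i,j})}+\lambda_{i,k}},\qquad \frac{p_{\theta_i}(\tau)}{p_\theta(\tau)}=\prod_{t=1}^T\frac{\pi_{\theta_i}(a_t|s_t)}{\pi_\theta(a_t|s_t)}.$$ **Theorem.** Under these assumptions, $J$ is differentiable on $\Theta$ and $G:=\sup_{\theta\in\Theta,\tau}\|\mathbf g_\theta(\tau)\|_2$ is finite. Let $\delta\in(0,1)$, let $\bar\theta\in\Theta$ be deterministic, or random and independent of $\mathcal H_k$, let $$N\ge\frac{4\,(d_\Theta\log 6+\log(1/\delta))}{3D},$$ and for every $i\in\{k_0,\dots,k\}$ take $$\alpha_{i,k}=\frac1{\omega_k},\qquad\lambda_{i,k}=\sqrt{\frac{4\,(d_\Theta\log 6+\log(1/\delta))}{3DN\omega_k}}.$$ Then, with probability at least $1-\delta$, $$\left\|\widehat\nabla^{\mathrm{MPM}}_{\omega_k}J(\bar\theta)-\nabla J(\bar\theta)\right\|_2\le 8G\sqrt{\frac{D\,(d_\Theta\log 6+\log(1/\delta))}{N\omega_k}}.$$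 -/

import Mathlib

open MeasureTheory ProbabilityTheory

noncomputable section

/-- A finite-horizon Markov decision process. The transition model and the initial distribution
are arbitrary (they need not have densities), rewards are bounded by `Rmax`. -/
structure MDP (S A : Type*) [MeasurableSpace S] [MeasurableSpace A] where
  /-- transition model `p(s' | s, a)` -/
  P : Kernel (S × A) S
  markov : IsMarkovKernel P
  /-- reward function -/
  r : S → A → ℝ
  measurable_r : Measurable fun x : S × A => r x.1 x.2
  Rmax : ℝ
  abs_r_le : ∀ s a, |r s a| ≤ Rmax
  /-- initial state distribution -/
  ρ₀ : Measure S
  prob : IsProbabilityMeasure ρ₀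
  /-- discount factor -/
  γ : ℝ
  γ_nonneg : 0 ≤ γ
  γ_le_one : γ ≤ 1
  /-- horizon -/
  T : ℕ

/-- A parametric stochastic policy with parameter space `Θ ⊆ ℝ^d`: `dens θ s a` is the density
`π_θ(a | s)` with respect to the reference measure `ν` on actions. Only the values at `θ ∈ Θ`
matter. -/
structure Policy (S : Type*) {A : Type*} [MeasurableSpace S] [MeasurableSpace A] {d : ℕ}
    (Θ : Set (EuclideanSpace ℝ (Fin d))) (ν : Measure A) where
  dens : EuclideanSpace ℝ (Fin d) → S → A → ℝ
  measurable_dens : Measurable fun x : Θ × S × A => dens x.1 x.2.1 x.2.2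
  dens_nonneg : ∀ θ ∈ Θ, ∀ s a, 0 ≤ dens θ s a
  lintegral_dens : ∀ θ ∈ Θ, ∀ s, ∫⁻ a, ENNReal.ofReal (dens θ s a) ∂ν = 1

/-- Law of the `T`-step trajectory `(s₁, a₁, …, s_T, a_T)` started from a given state `s₁`, when
actions are drawn from `κ` and states from `P`. -/
def trajKernel {S A : Type*} [MeasurableSpace S] [MeasurableSpace A]
    (P : Kernel (S × A) S) (κ : Kernel S A) : (T : ℕ) → Kernel S (Fin T → S × A)
  | 0 => Kernel.const S (Measure.dirac fun i => i.elim0)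
  | T + 1 =>
      (Kernel.id ×ₖ (κ ⊗ₖ (trajKernel P κ T ∘ₖ P))).map
        fun x : S × A × (Fin T → S × A) =>
          (Fin.cons (x.1, x.2.1) x.2.2 : Fin (T + 1) → S × A)

/-- The `χ²`-divergence `∫ (dP/dQ)² dQ - 1` for `P ≪ Q`, and `∞` otherwise. -/
def chiSq {X : Type*} [MeasurableSpace X] (P Q : Measure X) : ENNReal :=
  open Classical in
  if P ≪ Q then (∫⁻ x, (P.rnDeriv Q x) ^ 2 ∂Q) - 1 else ⊤

/-- The two classical single-trajectory policy gradient estimators. -/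
inductive EstimatorKind
  | reinforce
  | gpomdp

/-- The effective window size `ω_k = min {ω, k}`. -/
def winSize (w k : ℕ) : ℕ := min w k

/-- The first index `k₀ = k - ω_k + 1` of the window. -/
def winStart (w k : ℕ) : ℕ := k - winSize w k + 1

section

variable {S A : Type*} [MeasurableSpace S] [MeasurableSpace A]

/-- Trajectories `τ = (s₁, a₁, …, s_T, a_T)`. -/
abbrev MDP.Traj (M : MDP S A) : Type _ := Fin M.T → S × A

/-- Discounted return `R(τ)`; times are indexed from `0`. -/
def MDP.ret (M : MDP S A) (τ : M.Traj) : ℝ :=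
  ∑ t : Fin M.T, M.γ ^ (t : ℕ) * M.r (τ t).1 (τ t).2

variable {d : ℕ} {Θ : Set (EuclideanSpace ℝ (Fin d))} {ν : Measure A}

/-- The policy `π_θ` as a kernel from states to actions. -/
def Policy.kernel [SigmaFinite ν] (pol : Policy S Θ ν) (θ : EuclideanSpace ℝ (Fin d)) :
    Kernel S A :=
  (Kernel.const S ν).withDensity fun s a => ENNReal.ofReal (pol.dens θ s a)

/-- The trajectory distribution `p_θ`. -/
def Policy.trajLaw [SigmaFinite ν] (pol : Policy S Θ ν) (M : MDP S A)
    (θ : EuclideanSpace ℝ (Fin d)) : Measure M.Traj :=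
  M.ρ₀.bind (trajKernel M.P (pol.kernel θ) M.T)

/-- The expected return `J(θ)`. -/
def Policy.J [SigmaFinite ν] (pol : Policy S Θ ν) (M : MDP S A)
    (θ : EuclideanSpace ℝ (Fin d)) : ℝ :=
  ∫ τ, M.ret τ ∂(pol.trajLaw M θ)

/-- The score `∇_θ log π_θ(a | s)`. -/
def Policy.score (pol : Policy S Θ ν) (θ : EuclideanSpace ℝ (Fin d)) (s : S) (a : A) :
    EuclideanSpace ℝ (Fin d) :=
  gradient (fun θ' => Real.log (pol.dens θ' s a)) θ

/-- Regularity of `log π_θ`: it is defined (that is, `π_θ(a | s) > 0`) and twice differentiable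
in `θ`, with gradient and Hessian (in spectral norm) bounded uniformly in `θ`, `s`, `a`. -/
def Policy.LogRegular (pol : Policy S Θ ν) : Prop :=
  ∃ L₁ > 0, ∃ L₂ > 0, ∀ θ ∈ Θ, ∀ s a,
    0 < pol.dens θ s a ∧
    DifferentiableAt ℝ (fun θ' => Real.log (pol.dens θ' s a)) θ ∧
    DifferentiableAt ℝ (fun θ' => pol.score θ' s a) θ ∧
    ‖pol.score θ s a‖ ≤ L₁ ∧
    ‖fderiv ℝ (fun θ' => pol.score θ' s a) θ‖ ≤ L₂

/-- `sup_{θ₁, θ₂ ∈ Θ} χ²(p_{θ₁} ‖ p_{θ₂}) ≤ D - 1`. -/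
def Policy.ChiSqBounded [SigmaFinite ν] (pol : Policy S Θ ν) (M : MDP S A) (D : ℝ) : Prop :=
  ∀ θ₁ ∈ Θ, ∀ θ₂ ∈ Θ,
    chiSq (pol.trajLaw M θ₁) (pol.trajLaw M θ₂) ≤ ENNReal.ofReal (D - 1)

/-- The likelihood ratio `p_{θ₁}(τ) / p_{θ₂}(τ) = ∏_t π_{θ₁}(a_t | s_t) / π_{θ₂}(a_t | s_t)`
(the factors coming from the initial distribution and the transition model cancel). -/
def Policy.ratio (pol : Policy S Θ ν) (M : MDP S A) (θ₁ θ₂ : EuclideanSpace ℝ (Fin d))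
    (τ : M.Traj) : ℝ :=
  ∏ t, pol.dens θ₁ (τ t).1 (τ t).2 / pol.dens θ₂ (τ t).1 (τ t).2

/-- The single-trajectory gradient estimator `g_θ(τ)`. -/
def Policy.singleEstim (pol : Policy S Θ ν) (M : MDP S A) (e : EstimatorKind)
    (θ : EuclideanSpace ℝ (Fin d)) (τ : M.Traj) : EuclideanSpace ℝ (Fin d) :=
  match e with
  | .reinforce => M.ret τ • ∑ t, pol.score θ (τ t).1 (τ t).2
  | .gpomdp =>
      ∑ t : Fin M.T, (M.γ ^ (t : ℕ) * M.r (τ t).1 (τ t).2) •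
        ∑ l ∈ Finset.Iic t, pol.score θ (τ l).1 (τ l).2

/-- The set of all norms `‖g_θ(τ)‖₂`, for `θ ∈ Θ` and `τ` a trajectory. -/
def Policy.estimNorms (pol : Policy S Θ ν) (M : MDP S A) (e : EstimatorKind) : Set ℝ :=
  {x | ∃ θ ∈ Θ, ∃ τ : M.Traj, x = ‖pol.singleEstim M e θ τ‖}

/-- The multiple power mean estimator at `θ`, built from the parameters `θs i` and trajectories
`τs i j` of the window `i = k₀, …, k`, with batch size `N` and coefficients `α i`, `lam i`. -/
def Policy.mpm (pol : Policy S Θ ν) (M : MDP S A) (e : EstimatorKind) {N : ℕ} (w k : ℕ)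
    (α lam : ℕ → ℝ) (θs : ℕ → Θ) (τs : ℕ → Fin N → M.Traj)
    (θ : EuclideanSpace ℝ (Fin d)) : EuclideanSpace ℝ (Fin d) :=
  ∑ i ∈ Finset.Icc (winStart w k) k, (1 / (N : ℝ)) • ∑ j,
    (α i / ((1 - lam i) * pol.ratio M (θs i) θ (τs i j) + lam i)) •
      pol.singleEstim M e θ (τs i j)

end

section

variable {Ω Y Z : Type*} [MeasurableSpace Y] [MeasurableSpace Z]

/-- The σ-algebra generated by the history `(θ_1, τ_1, …, θ_k, τ_k)`. -/
abbrev historySigma (θs : ℕ → Ω → Y) (τs : ℕ → Ω → Z) (k : ℕ) : MeasurableSpace Ω :=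
  (⨆ l ∈ Finset.Icc 1 k, MeasurableSpace.comap (θs l) inferInstance) ⊔
    ⨆ l ∈ Finset.Icc 1 k, MeasurableSpace.comap (τs l) inferInstance

/-- The σ-algebra generated by `(θ_1, τ_1, …, θ_{i-1}, τ_{i-1}, θ_i)`. -/
abbrev pastSigma (θs : ℕ → Ω → Y) (τs : ℕ → Ω → Z) (i : ℕ) : MeasurableSpace Ω :=
  (⨆ l ∈ Finset.Icc 1 i, MeasurableSpace.comap (θs l) inferInstance) ⊔
    ⨆ l ∈ Finset.Ico 1 i, MeasurableSpace.comap (τs l) inferInstance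

end

/-- The random parameters `θ_i` and batches `τ_i = (τ_{i,1}, …, τ_{i,N})`, `i = 1, …, k`, form a
data-collection history: each `θ_i` may depend arbitrarily on the earlier data (and on extra
randomness) and, conditionally on the earlier data and on `θ_i`, the batch `τ_i` consists of `N`
independent trajectories drawn from `p_{θ_i}`. -/
structure IsHistory {S A : Type*} [MeasurableSpace S] [MeasurableSpace A] {d : ℕ}
    {Θ : Set (EuclideanSpace ℝ (Fin d))} {ν : Measure A} [SigmaFinite ν]
    (pol : Policy S Θ ν) (M : MDP S A) {Ω : Type*} [MeasurableSpace Ω] (μ : Measure Ω)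
    {N : ℕ} (k : ℕ) (θs : ℕ → Ω → Θ) (τs : ℕ → Ω → Fin N → M.Traj) : Prop where
  measurable_param : ∀ i ∈ Finset.Icc 1 k, Measurable (θs i)
  measurable_batch : ∀ i ∈ Finset.Icc 1 k, Measurable (τs i)
  cond_law : ∀ i ∈ Finset.Icc 1 k, ∀ B : Set (Fin N → M.Traj), MeasurableSet B →
    μ⟦τs i ⁻¹' B | pastSigma θs τs i⟧ =ᵐ[μ]
      fun ω => (Measure.pi fun _ : Fin N => pol.trajLaw M (θs i ω)).real B

end

/-! Write `ρ = p_θ / p_{θ_i}` for the importance weight of a trajectory. The weight in the estimator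
is the harmonic mean `W = 1 / ((1 - l) ρ⁻¹ + l)` of `ρ` and `1`. It is at most `1 / l`, its second
moment is controlled by that of `ρ`, and it differs from `ρ` by at most `l (ρ² - ρ + 1)`. The
divergence assumption says that `ρ²` has mean at most `D` under `p_{θ_i}`.

For a direction `v` in the unit ball put `X = ⟨v, g_θ⟩`, so `|X| ≤ G`. By change of measure and the
policy gradient theorem (`Policy.hasGradientAt_J`), `ρ X` has mean `⟨v, ∇J(θ)⟩`. At the scale `l /
G` the variable `l W X / G` stays in `[-1, 1]`, so `e^y ≤ 1 + y + y²` applies. The bias of `W` and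
its second moment each contribute at most `l² D`, giving exponential moment at most `exp (2 l² D)`
for the error of one term (`integral_exp_powerMean_sub_le`). Bias and variance are thus handled in
one estimate.

This bound is uniform in the behavioural parameter. Successive conditioning therefore multiplies it
over all `N ω_k` terms, although the parameters depend on the past (`IsHistory.lintegral_prod_le`).
Markov's inequality gives the tail in one direction, and a union bound over at most `5 ^ d` norming
vectors gives the tail of the norm (`IsHistory.measure_mpm_deviation_le`). A random target
independent of the history is treated by Fubini (`measure_le_of_indepFun`). -/

/-! ### A finite norming set. -/

/-- In a `d`-dimensional Euclidean space, `5 ^ d` vectors of norm at most `2` suffice to bound the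
norm of any vector by an inner product. -/
lemma exists_norming_finset (d : ℕ) :
    ∃ V : Finset (EuclideanSpace ℝ (Fin d)), V.card ≤ 5 ^ d ∧ (∀ v ∈ V, ‖v‖ ≤ 2) ∧
      ∀ x : EuclideanSpace ℝ (Fin d), ∃ v ∈ V, ‖x‖ ≤ inner ℝ v x := by
  classical
  let Sep : Finset (EuclideanSpace ℝ (Fin d)) → Prop := fun s =>
    (∀ c ∈ s, ‖c‖ ≤ 2) ∧ ∀ c ∈ s, ∀ c' ∈ s, c ≠ c' → 1 ≤ ‖c - c'‖
  have hbound : ∀ s, Sep s → s.card ≤ 5 ^ d := by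
    intro s hs
    simpa using Besicovitch.card_le_of_separated s hs.1 hs.2
  -- The volume bound caps the size of 1-separated subsets of the ball of radius 2, so one of
  -- largest size exists; maximality makes it a 1-net of that ball.
  obtain ⟨V, hV, hcard⟩ :=
    Nat.findGreatest_spec (P := fun n => ∃ s, Sep s ∧ s.card = n) (n := 5 ^ d) (Nat.zero_le _)
      ⟨∅, by simp [Sep]⟩
  have hmax : ∀ y : EuclideanSpace ℝ (Fin d), ‖y‖ ≤ 2 → ∃ c ∈ V, ‖y - c‖ ≤ 1 := by
    intro y hy
    by_contra! hcon
    have hyV : y ∉ V := fun h => by have := hcon y h; simp at this; linarith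
    have hins : Sep (insert y V) := by
      constructor
      · intro c hc
        rcases Finset.mem_insert.1 hc with rfl | hc
        exacts [hy, hV.1 c hc]
      · intro c hc c' hc' hcc
        rcases Finset.mem_insert.1 hc with h | h <;>
          rcases Finset.mem_insert.1 hc' with h' | h'
        · exact absurd (h.trans h'.symm) hcc
        · rw [h]; exact (hcon c' h').le
        · rw [norm_sub_rev, h']; exact (hcon c h).le
        · exact hV.2 c h c' h' hcc
    have hle := Nat.le_findGreatest (P := fun n => ∃ s, Sep s ∧ s.card = n)
      (hbound _ hins) ⟨_, hins, rfl⟩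
    rw [Finset.card_insert_of_notMem hyV] at hle
    omega
  refine ⟨V, hbound V hV, hV.1, fun x => ?_⟩
  rcases eq_or_ne x 0 with rfl | hx
  · obtain ⟨c, hc, -⟩ := hmax 0 (by simp)
    exact ⟨c, hc, by simp⟩
  have hx' : 0 < ‖x‖ := norm_pos_iff.2 hx
  -- Rescaling `x` to norm 2 leaves room for the net error: `⟨c, x⟩ ≥ 2‖x‖ - ‖x‖`.
  obtain ⟨c, hc, hcy⟩ := hmax ((2 / ‖x‖) • x) (by
    rw [norm_smul, Real.norm_of_nonneg (by positivity), div_mul_cancel₀ _ hx'.ne'])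
  refine ⟨c, hc, ?_⟩
  have h1 : inner ℝ ((2 / ‖x‖) • x - c) x ≤ ‖x‖ :=
    (real_inner_le_norm _ _).trans (by nlinarith)
  have h2 : inner ℝ ((2 / ‖x‖) • x) x = 2 * ‖x‖ := by
    rw [real_inner_smul_left, real_inner_self_eq_norm_sq]; field_simp
  rw [inner_sub_left, h2] at h1
  linarith

/-! ### Pointwise bounds on the power-mean weight. -/

/-- The power-mean weight is at most the inverse of the mixing parameter. -/
lemma powerMean_weight_le_inv {l r : ℝ} (hl : 0 < l) (hl1 : l ≤ 1) (hr : 0 < r) :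
    1 / ((1 - l) * r + l) ≤ 1 / l :=
  one_div_le_one_div_of_le hl (by nlinarith [mul_nonneg (sub_nonneg.2 hl1) hr.le])

/-- Second-moment bound for the power-mean weight in terms of the importance weight `ρ`. -/
lemma powerMean_weight_sq_le {l ρ : ℝ} (hl : 0 < l) (hl1 : l ≤ 1) (hρ : 0 < ρ) :
    (1 / ((1 - l) * ρ⁻¹ + l)) ^ 2 ≤ (1 - l) * ρ ^ 2 + l := by
  have hden : 0 < (1 - l) * ρ⁻¹ + l := by
    have := mul_nonneg (sub_nonneg.2 hl1) (inv_pos.2 hρ).le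
    linarith
  -- Harmonic mean at most arithmetic mean; convexity of the square then finishes.
  have h1 : 1 / ((1 - l) * ρ⁻¹ + l) ≤ (1 - l) * ρ + l := by
    rw [div_le_iff₀ hden]
    have : ((1 - l) * ρ + l) * ((1 - l) * ρ⁻¹ + l) - 1 = l * (1 - l) * (ρ - 1) ^ 2 * ρ⁻¹ := by
      field_simp; ring
    have h3 : 0 ≤ l * (1 - l) * (ρ - 1) ^ 2 * ρ⁻¹ := by
      have := sub_nonneg.2 hl1
      positivity
    linarith
  have h0 : 0 ≤ 1 / ((1 - l) * ρ⁻¹ + l) := by positivity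
  calc _ ≤ ((1 - l) * ρ + l) ^ 2 := by gcongr
    _ ≤ _ := by nlinarith [mul_nonneg (mul_nonneg hl.le (sub_nonneg.2 hl1)) (sq_nonneg (ρ - 1))]

/-- Bias bound for the power-mean weight in terms of the importance weight `ρ`. -/
lemma abs_powerMean_weight_sub_le {l ρ : ℝ} (hl : 0 < l) (hl1 : l ≤ 1) (hρ : 0 < ρ) :
    |1 / ((1 - l) * ρ⁻¹ + l) - ρ| ≤ l * (ρ ^ 2 - ρ + 1) := by
  have hden : 0 < (1 - l) + l * ρ := by
    have := mul_pos hl hρ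
    linarith
  have heq : 1 / ((1 - l) * ρ⁻¹ + l) - ρ = l * (ρ * (1 - ρ)) / ((1 - l) + l * ρ) := by
    have : (1 - l) * ρ⁻¹ + l = ((1 - l) + l * ρ) / ρ := by field_simp
    rw [this]
    field_simp
    ring
  rw [heq, abs_div, abs_of_pos hden, div_le_iff₀ hden, abs_mul, abs_of_pos hl, mul_assoc,
    abs_mul, abs_of_pos hρ]
  refine mul_le_mul_of_nonneg_left ?_ hl.le
  have hnn := sub_nonneg.2 hl1
  -- For `ρ ≤ 1` the denominator is at least `ρ` and `1 - ρ ≤ ρ² - ρ + 1`; for `ρ ≥ 1` it is at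
  -- least `1` and `ρ² - ρ ≤ ρ² - ρ + 1`.
  rcases le_total ρ 1 with h | h
  · rw [abs_of_nonneg (by linarith)]
    nlinarith [mul_nonneg hnn (sub_nonneg.2 h), mul_pos hl hρ, sq_nonneg (ρ - 1),
      mul_nonneg (sq_nonneg (ρ - 1)) hnn, mul_nonneg hρ.le (mul_nonneg hρ.le hρ.le),
      mul_nonneg (mul_nonneg hl.le hρ.le) (sq_nonneg ρ)]
  · rw [abs_of_nonpos (by linarith)]
    have : 1 ≤ (1 - l) + l * ρ := by nlinarith
    nlinarith [mul_nonneg (sub_nonneg.2 this) (by nlinarith : (0:ℝ) ≤ ρ ^ 2 - ρ + 1)]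

/-! ### Joint measurability of scores, estimators and likelihood ratios. -/

section ScoreMeasurability

variable {S A : Type*} [MeasurableSpace S] [MeasurableSpace A]
  {d : ℕ} {Θ : Set (EuclideanSpace ℝ (Fin d))} {ν : Measure A}

/-- Difference quotients evaluate the density at `θ + h v`, which may leave `Θ`; the filler value
`1` there keeps everything measurable on the whole space. -/
lemma Policy.measurable_dens_extend (hΘ : IsOpen Θ) (pol : Policy S Θ ν) :
    open Classical in Measurable fun x : EuclideanSpace ℝ (Fin d) × S × A =>
      if x.1 ∈ Θ then pol.dens x.1 x.2.1 x.2.2 else 1 := by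
  classical
  have hs : MeasurableSet {x : EuclideanSpace ℝ (Fin d) × S × A | x.1 ∈ Θ} :=
    measurable_fst hΘ.measurableSet
  have h1 : Measurable fun x : {x : EuclideanSpace ℝ (Fin d) × S × A | x.1 ∈ Θ} =>
      pol.dens x.1.1 x.1.2.1 x.1.2.2 :=
    pol.measurable_dens.comp
      (((measurable_fst.comp measurable_subtype_coe).subtype_mk (h := fun x => x.2)).prodMk
        (measurable_snd.comp measurable_subtype_coe))
  exact Measurable.dite h1 (measurable_const (a := (1 : ℝ))) hs

/-- Each directional derivative of `log π_θ` is a pointwise limit of jointly measurable difference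
quotients, and the score is recovered from its coordinates. -/
lemma Policy.measurable_score (hΘ : IsOpen Θ) (pol : Policy S Θ ν)
    (hdiff : ∀ θ ∈ Θ, ∀ s a, DifferentiableAt ℝ (fun θ' => Real.log (pol.dens θ' s a)) θ) :
    Measurable fun x : Θ × S × A => pol.score x.1 x.2.1 x.2.2 := by
  classical
  have key : ∀ v : EuclideanSpace ℝ (Fin d),
      Measurable fun x : Θ × S × A => inner ℝ v (pol.score x.1 x.2.1 x.2.2) := by
    intro v
    have hd := (pol.measurable_dens_extend hΘ).log
    let c : ℕ → ℝ := fun n => (n : ℝ) + 1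
    refine measurable_of_tendsto_metrizable (f := fun n (x : Θ × S × A) => c n *
      (Real.log (if (x.1 : EuclideanSpace ℝ (Fin d)) + (c n)⁻¹ • v ∈ Θ then
          pol.dens (x.1 + (c n)⁻¹ • v) x.2.1 x.2.2 else 1) -
        Real.log (if (x.1 : EuclideanSpace ℝ (Fin d)) ∈ Θ then
          pol.dens x.1 x.2.1 x.2.2 else 1))) (fun n => ?_) ?_
    · refine Measurable.const_mul (Measurable.sub ?_ ?_) _
      · exact hd.comp (((measurable_subtype_coe.comp measurable_fst).add_const
          ((c n)⁻¹ • v)).prodMk measurable_snd)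
      · exact hd.comp ((measurable_subtype_coe.comp measurable_fst).prodMk measurable_snd)
    · rw [tendsto_pi_nhds]
      rintro ⟨⟨θ, hθ⟩, s, a⟩
      have hc : Filter.Tendsto c Filter.atTop Filter.atTop :=
        Filter.tendsto_atTop_add_const_right _ _ tendsto_natCast_atTop_atTop
      have hlim := (hdiff θ hθ s a).hasGradientAt.hasFDerivAt.lim v (c := c)
        (l := Filter.atTop) (tendsto_norm_atTop_atTop.comp hc)
      have hval : (InnerProductSpace.toDual ℝ (EuclideanSpace ℝ (Fin d))
          (gradient (fun θ' => Real.log (pol.dens θ' s a)) θ)) v =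
          inner ℝ v (pol.score θ s a) := by
        rw [InnerProductSpace.toDual_apply_apply, real_inner_comm]; rfl
      rw [hval] at hlim
      refine hlim.congr' ?_
      -- Openness of `Θ` makes the filler value irrelevant in the limit.
      have hmem : ∀ᶠ n in Filter.atTop, θ + (c n)⁻¹ • v ∈ Θ := by
        have : Filter.Tendsto (fun n => θ + (c n)⁻¹ • v) Filter.atTop (nhds (θ + (0 : ℝ) • v)) :=
          tendsto_const_nhds.add ((tendsto_inv_atTop_zero.comp hc).smul_const v)
        rw [zero_smul, add_zero] at this
        exact this.eventually (hΘ.mem_nhds hθ)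
      filter_upwards [hmem] with n hn
      simp [hn, hθ]
  have hsum : (fun x : Θ × S × A => pol.score x.1 x.2.1 x.2.2) = fun x => ∑ i,
      (inner ℝ (EuclideanSpace.basisFun (Fin d) ℝ i) (pol.score x.1 x.2.1 x.2.2)) •
        EuclideanSpace.basisFun (Fin d) ℝ i := by
    ext1 x
    exact ((EuclideanSpace.basisFun (Fin d) ℝ).sum_repr' _).symm
  rw [hsum]
  exact Finset.measurable_sum _ fun i _ => (key _).smul_const _

lemma Policy.measurable_singleEstim (hΘ : IsOpen Θ) (pol : Policy S Θ ν)
    (hdiff : ∀ θ ∈ Θ, ∀ s a, DifferentiableAt ℝ (fun θ' => Real.log (pol.dens θ' s a)) θ)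
    (M : MDP S A) (e : EstimatorKind) :
    Measurable fun x : Θ × M.Traj => pol.singleEstim M e x.1 x.2 := by
  have hs : ∀ l : Fin M.T, Measurable fun x : Θ × M.Traj =>
      pol.score x.1 (x.2 l).1 (x.2 l).2 := fun l =>
    (pol.measurable_score hΘ hdiff).comp
      (measurable_fst.prodMk ((measurable_pi_apply l).comp measurable_snd))
  have hr : ∀ t : Fin M.T, Measurable fun x : Θ × M.Traj =>
      M.γ ^ (t : ℕ) * M.r (x.2 t).1 (x.2 t).2 := fun t =>
    (M.measurable_r.comp ((measurable_pi_apply t).comp measurable_snd)).const_mul _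
  cases e
  · exact (Finset.measurable_sum _ fun t _ => hr t).smul
      (Finset.measurable_sum _ fun t _ => hs t)
  · exact Finset.measurable_sum _ fun t _ => (hr t).smul
      (Finset.measurable_sum _ fun l _ => hs l)

lemma Policy.measurable_ratio (pol : Policy S Θ ν) (M : MDP S A) :
    Measurable fun x : Θ × Θ × M.Traj => pol.ratio M x.1 x.2.1 x.2.2 := by
  refine Finset.measurable_prod _ fun t _ => ?_
  have ht : Measurable fun x : Θ × Θ × M.Traj => x.2.2 t :=
    (measurable_pi_apply t).comp measurable_snd.snd
  exact (pol.measurable_dens.comp (measurable_fst.prodMk ht)).div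
    (pol.measurable_dens.comp (measurable_snd.fst.prodMk ht))

end ScoreMeasurability

/-! ### Change of measure for trajectories, by induction on the horizon. -/

section TrajKernel

variable {S A : Type*} [MeasurableSpace S] [MeasurableSpace A]

lemma measurable_finCons {X : Type*} [MeasurableSpace X] {n : ℕ} :
    Measurable fun x : X × (Fin n → X) => (Fin.cons x.1 x.2 : Fin (n + 1) → X) := by
  refine measurable_pi_iff.2 fun i => ?_
  refine Fin.cases ?_ (fun j => ?_) i
  · simpa using measurable_fst
  · simp only [Fin.cons_succ]
    exact (measurable_pi_apply j).comp measurable_snd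

lemma measurable_trajCons {T : ℕ} :
    Measurable fun x : S × A × (Fin T → S × A) =>
      (Fin.cons (x.1, x.2.1) x.2.2 : Fin (T + 1) → S × A) :=
  measurable_finCons.comp
    ((measurable_fst.prodMk measurable_snd.fst).prodMk measurable_snd.snd)

variable (P : Kernel (S × A) S) [IsMarkovKernel P]

instance isMarkovKernel_trajKernel (κ : Kernel S A) [IsMarkovKernel κ] (T : ℕ) :
    IsMarkovKernel (trajKernel P κ T) := by
  induction T with
  | zero => rw [trajKernel]; infer_instance
  | succ T ih => rw [trajKernel]; exact Kernel.IsMarkovKernel.map _ measurable_trajCons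

/-- The first step is split off; both inductions below run on this recursion. -/
lemma lintegral_trajKernel_succ (κ : Kernel S A) [IsMarkovKernel κ] (T : ℕ) (s : S)
    {h : (Fin (T + 1) → S × A) → ENNReal} (hh : Measurable h) :
    ∫⁻ τ, h τ ∂trajKernel P κ (T + 1) s =
      ∫⁻ a, ∫⁻ τ, h (Fin.cons (s, a) τ) ∂(trajKernel P κ T ∘ₖ P) (s, a) ∂κ s := by
  rw [trajKernel, Kernel.lintegral_map _ measurable_trajCons _ hh,
    Kernel.lintegral_id_prod
      (f := fun x : S × A × (Fin T → S × A) => h (Fin.cons (x.1, x.2.1) x.2.2))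
      (hh.comp measurable_trajCons), Kernel.lintegral_compProd]
  exact (hh.comp measurable_trajCons).comp measurable_prodMk_left

/-- Change of measure for trajectories when the action kernel is reweighted. -/
lemma lintegral_trajKernel_of_density (κ κ' : Kernel S A) [IsMarkovKernel κ] [IsMarkovKernel κ']
    {f : S × A → ENNReal} (hf : Measurable f)
    (hκ : ∀ s (h : A → ENNReal), Measurable h →
      ∫⁻ a, h a ∂κ' s = ∫⁻ a, f (s, a) * h a ∂κ s) (T : ℕ) :
    ∀ (s : S) {h : (Fin T → S × A) → ENNReal}, Measurable h →
      ∫⁻ τ, h τ ∂trajKernel P κ' T s = ∫⁻ τ, (∏ t, f (τ t)) * h τ ∂trajKernel P κ T s := by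
  induction T with
  | zero => intro s h _; simp [trajKernel]
  | succ T ih =>
    intro s h hh
    have hcons : Measurable fun x : (S × A) × (Fin T → S × A) =>
        h (Fin.cons x.1 x.2) := hh.comp measurable_finCons
    have hprod : ∀ n, Measurable fun τ : Fin n → S × A => ∏ t, f (τ t) := fun n =>
      Finset.measurable_prod _ fun t _ => hf.comp (measurable_pi_apply t)
    rw [lintegral_trajKernel_succ P κ' T s hh,
      lintegral_trajKernel_succ P κ T s
        (h := fun τ => (∏ t, f (τ t)) * h τ) ((hprod _).mul hh), hκ]
    · refine lintegral_congr fun a => ?_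
      have hc : Measurable fun τ : Fin T → S × A => h (Fin.cons (s, a) τ) :=
        hcons.comp measurable_prodMk_left
      rw [Kernel.lintegral_comp _ _ _ hc]
      simp_rw [Fin.prod_univ_succ, Fin.cons_zero, Fin.cons_succ, mul_assoc]
      have hpc : Measurable fun τ : Fin T → S × A => (∏ t, f (τ t)) * h (Fin.cons (s, a) τ) :=
        (hprod T).mul hc
      rw [lintegral_const_mul _ hpc, Kernel.lintegral_comp _ _ _ hpc]
      congr 1
      exact lintegral_congr fun s' => ih s' hc
    · exact (Measurable.lintegral_kernel_prod_right (κ := trajKernel P κ' T ∘ₖ P)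
        (f := fun x τ => h (Fin.cons x τ)) hcons).comp measurable_prodMk_left

/-- For a function of the `t`-th step, the density factors after `t` integrate to one. -/
lemma lintegral_trajKernel_eval_of_density (κ κ' : Kernel S A) [IsMarkovKernel κ]
    [IsMarkovKernel κ'] {f : S × A → ENNReal} (hf : Measurable f)
    (hκ : ∀ s (h : A → ENNReal), Measurable h →
      ∫⁻ a, h a ∂κ' s = ∫⁻ a, f (s, a) * h a ∂κ s)
    {q : S × A → ENNReal} (hq : Measurable q) (T : ℕ) :
    ∀ (s : S) (t : Fin T),
      ∫⁻ τ, q (τ t) ∂trajKernel P κ' T s =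
        ∫⁻ τ, (∏ l ∈ Finset.Iic t, f (τ l)) * q (τ t) ∂trajKernel P κ T s := by
  induction T with
  | zero => intro s t; exact t.elim0
  | succ T ih =>
    intro s t
    have hqt : ∀ {n} (t : Fin n), Measurable fun τ : Fin n → S × A => q (τ t) :=
      fun t => hq.comp (measurable_pi_apply t)
    have hprod : ∀ {n} (t : Fin n), Measurable fun τ : Fin n → S × A =>
        (∏ l ∈ Finset.Iic t, f (τ l)) * q (τ t) := fun t =>
      (Finset.measurable_prod _ fun l _ => hf.comp (measurable_pi_apply l)).mul (hqt t)
    rw [lintegral_trajKernel_succ P κ' T s (hqt t), lintegral_trajKernel_succ P κ T s (hprod t)]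
    refine Fin.cases ?_ (fun t => ?_) t
    -- At time `0` the rest of the trajectory has total mass one, so only the reweighting of a
    -- single action remains.
    · have : Finset.Iic (0 : Fin (T + 1)) = {0} := by ext; simp
      simp only [this, Fin.cons_zero, lintegral_const, measure_univ, mul_one,
        Finset.prod_singleton]
      exact hκ s _ (hq.comp measurable_prodMk_left)
    · have hI : Finset.Iic t.succ = Finset.cons 0 ((Finset.Iic t).map (Fin.succEmb T))
          (by simp) := by
        ext i
        refine Fin.cases ?_ (fun j => ?_) i
        · simp
        · simp
      simp only [Fin.cons_succ, hI, Finset.prod_cons, Fin.cons_zero, Finset.prod_map,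
        Fin.coe_succEmb, mul_assoc]
      rw [hκ]
      · refine lintegral_congr fun a => ?_
        rw [lintegral_const_mul _ (hprod t), Kernel.lintegral_comp _ _ _ (hqt t),
          Kernel.lintegral_comp _ _ _ (hprod t)]
        congr 1
        exact lintegral_congr fun s' => ih s' t
      · exact (Measurable.lintegral_kernel_prod_right (κ := trajKernel P κ' T ∘ₖ P)
          (f := fun _ τ => q (τ t)) ((hqt t).comp measurable_snd)).comp measurable_prodMk_left

end TrajKernel

/-! ### Importance weights between policies. -/

/-- The steps whose scores multiply the reward at time `t` in the given estimator. -/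
def EstimatorKind.steps (e : EstimatorKind) {n : ℕ} (t : Fin n) : Finset (Fin n) :=
  match e with
  | .reinforce => Finset.univ
  | .gpomdp => Finset.Iic t

section ChangeOfMeasure

variable {S A : Type*} [MeasurableSpace S] [MeasurableSpace A]
  {d : ℕ} {Θ : Set (EuclideanSpace ℝ (Fin d))} {ν : Measure A}

lemma Policy.singleEstim_eq_sum (pol : Policy S Θ ν) (M : MDP S A) (e : EstimatorKind)
    (θ : EuclideanSpace ℝ (Fin d)) (τ : M.Traj) :
    pol.singleEstim M e θ τ = ∑ t : Fin M.T, (M.γ ^ (t : ℕ) * M.r (τ t).1 (τ t).2) •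
      ∑ l ∈ e.steps t, pol.score θ (τ l).1 (τ l).2 := by
  cases e
  · simp [singleEstim, EstimatorKind.steps, MDP.ret, Finset.sum_smul]
  · rfl

lemma Policy.measurable_dens_apply (pol : Policy S Θ ν) {θ : EuclideanSpace ℝ (Fin d)}
    (hθ : θ ∈ Θ) : Measurable fun x : S × A => pol.dens θ x.1 x.2 :=
  pol.measurable_dens.comp ((measurable_const (a := (⟨θ, hθ⟩ : Θ))).prodMk measurable_id)

lemma Policy.measurable_stepRatio (pol : Policy S Θ ν) {θ θ' : EuclideanSpace ℝ (Fin d)} (hθ : θ ∈ Θ)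
    (hθ' : θ' ∈ Θ) : Measurable fun x : S × A => pol.dens θ' x.1 x.2 / pol.dens θ x.1 x.2 :=
  (pol.measurable_dens_apply hθ').div (pol.measurable_dens_apply hθ)

lemma Policy.measurable_prod_stepRatio (pol : Policy S Θ ν) (M : MDP S A)
    {θ θ' : EuclideanSpace ℝ (Fin d)} (hθ : θ ∈ Θ)
    (hθ' : θ' ∈ Θ) (I : Finset (Fin M.T)) :
    Measurable fun τ : M.Traj =>
      ∏ l ∈ I, pol.dens θ' (τ l).1 (τ l).2 / pol.dens θ (τ l).1 (τ l).2 :=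
  Finset.measurable_prod _ fun l _ =>
    (pol.measurable_stepRatio hθ hθ').comp (measurable_pi_apply l)

variable [SigmaFinite ν]

lemma Policy.lintegral_kernel (pol : Policy S Θ ν) {θ : EuclideanSpace ℝ (Fin d)}
    (hθ : θ ∈ Θ) (s : S) {h : A → ENNReal} (hh : Measurable h) :
    ∫⁻ a, h a ∂pol.kernel θ s = ∫⁻ a, ENNReal.ofReal (pol.dens θ s a) * h a ∂ν := by
  rw [kernel, Kernel.lintegral_withDensity _ (pol.measurable_dens_apply hθ).ennreal_ofReal s hh,
    Kernel.const_apply]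

lemma Policy.isMarkovKernel_kernel (pol : Policy S Θ ν) {θ : EuclideanSpace ℝ (Fin d)}
    (hθ : θ ∈ Θ) : IsMarkovKernel (pol.kernel θ) := by
  refine ⟨fun s => ⟨?_⟩⟩
  rw [← lintegral_one, pol.lintegral_kernel hθ s measurable_const]
  simpa using pol.lintegral_dens θ hθ s

lemma Policy.lintegral_kernel_of_density (pol : Policy S Θ ν)
    (hpos : ∀ θ ∈ Θ, ∀ s a, 0 < pol.dens θ s a) {θ θ' : EuclideanSpace ℝ (Fin d)}
    (hθ : θ ∈ Θ) (hθ' : θ' ∈ Θ) (s : S) (h : A → ENNReal) (hh : Measurable h) :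
    ∫⁻ a, h a ∂pol.kernel θ' s =
      ∫⁻ a, ENNReal.ofReal (pol.dens θ' s a / pol.dens θ s a) * h a ∂pol.kernel θ s := by
  have hm : ∀ {θ}, θ ∈ Θ → Measurable fun a => pol.dens θ s a := fun hθ =>
    (pol.measurable_dens_apply hθ).comp measurable_prodMk_left
  have hw : Measurable fun a => ENNReal.ofReal (pol.dens θ' s a / pol.dens θ s a) * h a :=
    ((hm hθ').div (hm hθ)).ennreal_ofReal.mul hh
  rw [pol.lintegral_kernel hθ' s hh, pol.lintegral_kernel hθ s hw]
  refine lintegral_congr fun a => ?_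
  rw [← mul_assoc, ← ENNReal.ofReal_mul (hpos θ hθ s a).le, mul_div_cancel₀ _ (hpos θ hθ s a).ne']

variable (pol : Policy S Θ ν) (M : MDP S A)

lemma Policy.isProbabilityMeasure_trajLaw {θ : EuclideanSpace ℝ (Fin d)} (hθ : θ ∈ Θ) :
    IsProbabilityMeasure (pol.trajLaw M θ) := by
  have := pol.isMarkovKernel_kernel hθ
  have := M.markov
  have := M.prob
  rw [trajLaw]
  infer_instance

variable {pol}

lemma Policy.lintegral_trajLaw_of_density (hpos : ∀ θ ∈ Θ, ∀ s a, 0 < pol.dens θ s a)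
    {θ θ' : EuclideanSpace ℝ (Fin d)} (hθ : θ ∈ Θ) (hθ' : θ' ∈ Θ) {h : M.Traj → ENNReal}
    (hh : Measurable h) :
    ∫⁻ τ, h τ ∂pol.trajLaw M θ' =
      ∫⁻ τ, ENNReal.ofReal (pol.ratio M θ' θ τ) * h τ ∂pol.trajLaw M θ := by
  have := pol.isMarkovKernel_kernel hθ
  have := pol.isMarkovKernel_kernel hθ'
  have := M.markov
  have hr : Measurable fun τ => ENNReal.ofReal (pol.ratio M θ' θ τ) * h τ :=
    (pol.measurable_prod_stepRatio M hθ hθ' Finset.univ).ennreal_ofReal.mul hh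
  rw [trajLaw, trajLaw, Measure.lintegral_bind (Kernel.aemeasurable _) hh.aemeasurable,
    Measure.lintegral_bind (Kernel.aemeasurable _) hr.aemeasurable]
  refine lintegral_congr fun s => ?_
  rw [lintegral_trajKernel_of_density M.P (pol.kernel θ) (pol.kernel θ')
    (pol.measurable_stepRatio hθ hθ').ennreal_ofReal
    (pol.lintegral_kernel_of_density hpos hθ hθ') M.T s hh]
  refine lintegral_congr fun τ => ?_
  rw [ratio, ENNReal.ofReal_prod_of_nonneg]
  exact fun l _ => (div_pos (hpos _ hθ' _ _) (hpos _ hθ _ _)).le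

/-- Initial law and transitions are common to both parameters, so only the policy ratios enter and
no densities are needed for the dynamics. -/
lemma Policy.trajLaw_eq_withDensity (hpos : ∀ θ ∈ Θ, ∀ s a, 0 < pol.dens θ s a)
    {θ θ' : EuclideanSpace ℝ (Fin d)} (hθ : θ ∈ Θ) (hθ' : θ' ∈ Θ) :
    pol.trajLaw M θ' =
      (pol.trajLaw M θ).withDensity fun τ => ENNReal.ofReal (pol.ratio M θ' θ τ) := by
  ext B hB
  rw [withDensity_apply _ hB, ← lintegral_indicator_one hB,
    lintegral_trajLaw_of_density M hpos hθ hθ' (measurable_one.indicator hB),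
    ← lintegral_indicator hB]
  refine lintegral_congr fun τ => ?_
  by_cases h : τ ∈ B <;> simp [h]

/-- The two estimators correspond to two valid weights for a reward at time `t`: the full likelihood
ratio, or the ratio up to `t` because later factors integrate to one. -/
lemma Policy.lintegral_trajLaw_eval_of_density (hpos : ∀ θ ∈ Θ, ∀ s a, 0 < pol.dens θ s a)
    {θ θ' : EuclideanSpace ℝ (Fin d)} (hθ : θ ∈ Θ) (hθ' : θ' ∈ Θ) (e : EstimatorKind)
    (t : Fin M.T) {q : S × A → ENNReal} (hq : Measurable q) :
    ∫⁻ τ, q (τ t) ∂pol.trajLaw M θ' =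
      ∫⁻ τ, ENNReal.ofReal (∏ l ∈ e.steps t,
        pol.dens θ' (τ l).1 (τ l).2 / pol.dens θ (τ l).1 (τ l).2) * q (τ t)
        ∂pol.trajLaw M θ := by
  have hqt : Measurable fun τ : M.Traj => q (τ t) := hq.comp (measurable_pi_apply t)
  cases e with
  | reinforce => exact lintegral_trajLaw_of_density M hpos hθ hθ' hqt
  | gpomdp =>
    have := pol.isMarkovKernel_kernel hθ
    have := pol.isMarkovKernel_kernel hθ'
    have := M.markov
    have hr : Measurable fun τ : M.Traj =>
        ENNReal.ofReal (∏ l ∈ EstimatorKind.gpomdp.steps t,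
          pol.dens θ' (τ l).1 (τ l).2 / pol.dens θ (τ l).1 (τ l).2) * q (τ t) :=
      (pol.measurable_prod_stepRatio M hθ hθ' _).ennreal_ofReal.mul hqt
    rw [trajLaw, trajLaw, Measure.lintegral_bind (Kernel.aemeasurable _) hqt.aemeasurable,
      Measure.lintegral_bind (Kernel.aemeasurable _) hr.aemeasurable]
    refine lintegral_congr fun s => ?_
    rw [lintegral_trajKernel_eval_of_density M.P (pol.kernel θ) (pol.kernel θ')
      (pol.measurable_stepRatio hθ hθ').ennreal_ofReal
      (pol.lintegral_kernel_of_density hpos hθ hθ') hq M.T s t]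
    refine lintegral_congr fun τ => ?_
    rw [EstimatorKind.steps, ENNReal.ofReal_prod_of_nonneg]
    exact fun l _ => (div_pos (hpos _ hθ' _ _) (hpos _ hθ _ _)).le

/-- The lower-integral identity says that two image measures on `S × A` coincide; passing through
this equality avoids any integrability condition on `q`. -/
lemma Policy.integral_trajLaw_eval_of_density (hpos : ∀ θ ∈ Θ, ∀ s a, 0 < pol.dens θ s a)
    {θ θ' : EuclideanSpace ℝ (Fin d)} (hθ : θ ∈ Θ) (hθ' : θ' ∈ Θ) (e : EstimatorKind)
    (t : Fin M.T) {q : S × A → ℝ} (hq : Measurable q) :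
    ∫ τ, q (τ t) ∂pol.trajLaw M θ' =
      ∫ τ, (∏ l ∈ e.steps t,
        pol.dens θ' (τ l).1 (τ l).2 / pol.dens θ (τ l).1 (τ l).2) * q (τ t)
        ∂pol.trajLaw M θ := by
  have hw := (pol.measurable_prod_stepRatio M hθ hθ' (e.steps t)).ennreal_ofReal
  have ht : Measurable fun τ : M.Traj => τ t := measurable_pi_apply t
  have hmap : (pol.trajLaw M θ').map (fun τ => τ t) =
      ((pol.trajLaw M θ).withDensity fun τ => ENNReal.ofReal (∏ l ∈ e.steps t,
        pol.dens θ' (τ l).1 (τ l).2 / pol.dens θ (τ l).1 (τ l).2)).map (fun τ => τ t) := by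
    refine Measure.ext_of_lintegral _ fun q hq => ?_
    rw [lintegral_map hq ht, lintegral_map hq ht,
      lintegral_withDensity_eq_lintegral_mul (g := fun τ : M.Traj => q (τ t)) _ hw (hq.comp ht)]
    exact lintegral_trajLaw_eval_of_density M hpos hθ hθ' e t hq
  rw [← integral_map (φ := fun τ : M.Traj => τ t) (f := q) ht.aemeasurable
      hq.aestronglyMeasurable, hmap,
    integral_map ht.aemeasurable hq.aestronglyMeasurable,
    integral_withDensity_eq_integral_toReal_smul hw (by simp)]
  refine integral_congr_ae (Filter.Eventually.of_forall fun τ => ?_)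
  simp only [smul_eq_mul]
  rw [ENNReal.toReal_ofReal]
  exact Finset.prod_nonneg fun l _ => (div_pos (hpos _ hθ' _ _) (hpos _ hθ _ _)).le

end ChangeOfMeasure

/-! ### The policy gradient theorem. -/

section PolicyGradient

variable {S A : Type*} [MeasurableSpace S] [MeasurableSpace A]
  {d : ℕ} {Θ : Set (EuclideanSpace ℝ (Fin d))} {ν : Measure A}

lemma MDP.abs_discounted_le (M : MDP S A) (n : ℕ) (s : S) (a : A) :
    |M.γ ^ n * M.r s a| ≤ M.Rmax := by
  have h1 : M.γ ^ n ≤ 1 := pow_le_one₀ M.γ_nonneg M.γ_le_one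
  have h0 : 0 ≤ M.γ ^ n := pow_nonneg M.γ_nonneg n
  rw [abs_mul, abs_of_nonneg h0]
  exact (mul_le_of_le_one_left (abs_nonneg _) h1).trans (M.abs_r_le s a)

lemma Policy.norm_sum_score_le (pol : Policy S Θ ν) (M : MDP S A) {L : ℝ} (hL : 0 ≤ L)
    {θ : EuclideanSpace ℝ (Fin d)} (hscore : ∀ s a, ‖pol.score θ s a‖ ≤ L)
    (I : Finset (Fin M.T)) (τ : M.Traj) :
    ‖∑ l ∈ I, pol.score θ (τ l).1 (τ l).2‖ ≤ M.T * L := by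
  calc _ ≤ ∑ _l ∈ I, L := norm_sum_le_of_le _ fun l _ => hscore _ _
    _ = I.card * L := by simp
    _ ≤ M.T * L := by
      gcongr
      simpa using Finset.card_le_univ I

lemma Policy.norm_singleEstim_le (pol : Policy S Θ ν) (M : MDP S A) (e : EstimatorKind)
    {L : ℝ} (hL : 0 ≤ L) {θ : EuclideanSpace ℝ (Fin d)}
    (hscore : ∀ s a, ‖pol.score θ s a‖ ≤ L) (τ : M.Traj) :
    ‖pol.singleEstim M e θ τ‖ ≤ M.T * (M.Rmax * (M.T * L)) := by
  rw [singleEstim_eq_sum]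
  calc _ ≤ ∑ _t : Fin M.T, M.Rmax * (M.T * L) := by
        refine norm_sum_le_of_le _ fun t _ => ?_
        rw [norm_smul]
        exact mul_le_mul (M.abs_discounted_le t _ _) (pol.norm_sum_score_le M hL hscore _ τ)
          (norm_nonneg _) ((abs_nonneg _).trans (M.abs_discounted_le t (τ t).1 (τ t).2))
    _ = _ := by simp

lemma Policy.bddAbove_estimNorms (pol : Policy S Θ ν) (hreg : pol.LogRegular) (M : MDP S A)
    (e : EstimatorKind) : BddAbove (pol.estimNorms M e) := by
  obtain ⟨L₁, hL₁, L₂, -, hreg⟩ := hreg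
  refine ⟨M.T * (M.Rmax * (M.T * L₁)), ?_⟩
  rintro x ⟨θ, hθ, τ, rfl⟩
  exact pol.norm_singleEstim_le M e hL₁.le (fun s a => (hreg θ hθ s a).2.2.2.1) τ

variable [SigmaFinite ν] (pol : Policy S Θ ν) (M : MDP S A)

lemma Policy.integrable_singleEstim (hΘ : IsOpen Θ) (hreg : pol.LogRegular) (e : EstimatorKind)
    {θ : EuclideanSpace ℝ (Fin d)} (hθ : θ ∈ Θ) :
    Integrable (pol.singleEstim M e θ) (pol.trajLaw M θ) := by
  obtain ⟨L₁, hL₁, L₂, -, hreg⟩ := hreg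
  have := pol.isProbabilityMeasure_trajLaw M hθ
  have hm := (pol.measurable_singleEstim hΘ (fun θ hθ s a => (hreg θ hθ s a).2.1) M e).comp
    (measurable_prodMk_left (x := (⟨θ, hθ⟩ : Θ)))
  exact Integrable.of_bound hm.aestronglyMeasurable _ (Filter.Eventually.of_forall
    (pol.norm_singleEstim_le M e hL₁.le (fun s a => (hreg θ hθ s a).2.2.2.1)))

/-- The return at `θ'` as an expectation under `θ`, with the importance weights relevant to the
given estimator. -/
lemma Policy.J_eq_integral (hpos : ∀ θ ∈ Θ, ∀ s a, 0 < pol.dens θ s a)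
    {θ θ' : EuclideanSpace ℝ (Fin d)} (hθ : θ ∈ Θ) (hθ' : θ' ∈ Θ) (e : EstimatorKind)
    (hint : ∀ t : Fin M.T, Integrable (fun τ : M.Traj => M.γ ^ (t : ℕ) * M.r (τ t).1 (τ t).2 *
      Real.exp (∑ l ∈ e.steps t, (Real.log (pol.dens θ' (τ l).1 (τ l).2) -
        Real.log (pol.dens θ (τ l).1 (τ l).2)))) (pol.trajLaw M θ)) :
    pol.J M θ' = ∫ τ, ∑ t : Fin M.T, M.γ ^ (t : ℕ) * M.r (τ t).1 (τ t).2 *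
      Real.exp (∑ l ∈ e.steps t, (Real.log (pol.dens θ' (τ l).1 (τ l).2) -
        Real.log (pol.dens θ (τ l).1 (τ l).2))) ∂pol.trajLaw M θ := by
  have := pol.isProbabilityMeasure_trajLaw M hθ'
  have hm : ∀ t : Fin M.T, Measurable fun x : S × A => M.γ ^ (t : ℕ) * M.r x.1 x.2 :=
    fun t => M.measurable_r.const_mul _
  rw [J]
  simp only [MDP.ret]
  rw [integral_finsetSum, integral_finsetSum _ fun t _ => hint t]
  · refine Finset.sum_congr rfl fun t _ => ?_
    rw [integral_trajLaw_eval_of_density M hpos hθ hθ' e t (hm t)]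
    refine integral_congr_ae (Filter.Eventually.of_forall fun τ => ?_)
    simp only
    rw [mul_comm, Real.exp_sum]
    congr 1
    refine Finset.prod_congr rfl fun l _ => ?_
    rw [Real.exp_sub, Real.exp_log (hpos _ hθ' _ _), Real.exp_log (hpos _ hθ _ _)]
  · intro t _
    exact Integrable.of_bound ((hm t).comp (measurable_pi_apply t)).aestronglyMeasurable M.Rmax
      (Filter.Eventually.of_forall fun τ => M.abs_discounted_le t _ _)

/-- Policy gradient theorem: both single-trajectory estimators are unbiased. -/
theorem Policy.hasGradientAt_J (hΘ : IsOpen Θ) (hreg : pol.LogRegular) (e : EstimatorKind)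
    {θ : EuclideanSpace ℝ (Fin d)} (hθ : θ ∈ Θ) :
    HasGradientAt (pol.J M) (∫ τ, pol.singleEstim M e θ τ ∂pol.trajLaw M θ) θ := by
  have hgint := pol.integrable_singleEstim M hΘ hreg e hθ
  obtain ⟨L₁, hL₁, L₂, -, hreg⟩ := hreg
  have hpos : ∀ θ ∈ Θ, ∀ s a, 0 < pol.dens θ s a := fun θ hθ s a => (hreg θ hθ s a).1
  have hprob := pol.isProbabilityMeasure_trajLaw M hθ
  -- On a ball inside `Θ`, which is convex, the score bound makes `log π` Lipschitz; this bounds the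
  -- importance weights and supplies the dominating constant.
  obtain ⟨ε, hε, hball⟩ := Metric.isOpen_iff.1 hΘ θ hθ
  let c : Fin M.T → M.Traj → ℝ := fun t τ => M.γ ^ (t : ℕ) * M.r (τ t).1 (τ t).2
  -- Writing the likelihood ratio as an exponential of log differences makes its derivative the
  -- ratio times a sum of scores.
  let w : Fin M.T → EuclideanSpace ℝ (Fin d) → M.Traj → ℝ := fun t θ' τ =>
    Real.exp (∑ l ∈ e.steps t, (Real.log (pol.dens θ' (τ l).1 (τ l).2) -
        Real.log (pol.dens θ (τ l).1 (τ l).2)))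
  let F : EuclideanSpace ℝ (Fin d) → M.Traj → ℝ := fun θ' τ => ∑ t, c t τ * w t θ' τ
  let g : EuclideanSpace ℝ (Fin d) → M.Traj → EuclideanSpace ℝ (Fin d) := fun θ' τ =>
    ∑ t, (c t τ * w t θ' τ) • ∑ l ∈ e.steps t, pol.score θ' (τ l).1 (τ l).2
  have hcle : ∀ t τ, |c t τ| ≤ M.Rmax := fun t τ => M.abs_discounted_le t _ _
  have hdlog : ∀ θ' ∈ Θ, ∀ s a, HasFDerivAt (fun θ' => Real.log (pol.dens θ' s a))
      (InnerProductSpace.toDual ℝ _ (pol.score θ' s a)) θ' := fun θ' hθ' s a =>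
    (hreg θ' hθ' s a).2.1.hasGradientAt.hasFDerivAt
  have hlog : ∀ θ' ∈ Metric.ball θ ε, ∀ s a,
      Real.log (pol.dens θ' s a) - Real.log (pol.dens θ s a) ≤ L₁ * ε := by
    intro θ' hθ' s a
    have h := (convex_ball θ ε).norm_image_sub_le_of_norm_hasFDerivWithin_le (C := L₁)
      (fun x hx => (hdlog x (hball hx) s a).hasFDerivWithinAt)
      (fun x hx => by
        rw [LinearIsometryEquiv.norm_map]; exact (hreg x (hball hx) s a).2.2.2.1)
      (Metric.mem_ball_self hε) hθ'
    refine (le_abs_self _).trans (h.trans ?_)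
    gcongr
    exact (mem_ball_iff_norm.1 hθ').le
  have hwle : ∀ t, ∀ θ' ∈ Metric.ball θ ε, ∀ τ, w t θ' τ ≤ Real.exp (M.T * (L₁ * ε)) := by
    intro t θ' hθ' τ
    refine Real.exp_le_exp.2 ?_
    calc _ ≤ ∑ _l ∈ e.steps t, L₁ * ε := Finset.sum_le_sum fun l _ => hlog θ' hθ' _ _
      _ = (e.steps t).card * (L₁ * ε) := by simp
      _ ≤ _ := by
        gcongr
        simpa using Finset.card_le_univ (e.steps t)
  have hcwm : ∀ t, ∀ θ' ∈ Θ, Measurable fun τ => c t τ * w t θ' τ := by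
    intro t θ' hθ'
    have hl : ∀ θ ∈ Θ, ∀ l, Measurable fun τ : M.Traj =>
        Real.log (pol.dens θ (τ l).1 (τ l).2) := fun θ hθ l =>
      ((pol.measurable_dens_apply hθ).comp (measurable_pi_apply l)).log
    exact ((M.measurable_r.comp (measurable_pi_apply t)).const_mul _).mul
      (Finset.measurable_sum _ fun l _ => (hl θ' hθ' l).sub (hl θ hθ l)).exp
  have hcwle : ∀ t, ∀ θ' ∈ Metric.ball θ ε, ∀ τ,
      ‖c t τ * w t θ' τ‖ ≤ M.Rmax * Real.exp (M.T * (L₁ * ε)) := by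
    intro t θ' hθ' τ
    rw [norm_mul, Real.norm_eq_abs, Real.norm_of_nonneg (Real.exp_pos _).le]
    exact mul_le_mul (hcle t τ) (hwle t θ' hθ' τ) (Real.exp_pos _).le
      ((abs_nonneg _).trans (hcle t τ))
  have hcwint : ∀ t, ∀ θ' ∈ Metric.ball θ ε,
      Integrable (fun τ => c t τ * w t θ' τ) (pol.trajLaw M θ) := fun t θ' hθ' =>
    Integrable.of_bound (hcwm t θ' (hball hθ')).aestronglyMeasurable _
      (Filter.Eventually.of_forall (hcwle t θ' hθ'))
  -- At the base point all importance weights equal one.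
  have hgθ : ∀ τ, g θ τ = pol.singleEstim M e θ τ := by
    intro τ
    simp [g, c, w, pol.singleEstim_eq_sum]
  have hF : HasFDerivAt (fun θ' => ∫ τ, F θ' τ ∂pol.trajLaw M θ)
      (∫ τ, InnerProductSpace.toDual ℝ _ (g θ τ) ∂pol.trajLaw M θ) θ := by
    refine hasFDerivAt_integral_of_dominated_of_fderiv_le
      (F' := fun θ' τ => InnerProductSpace.toDual ℝ _ (g θ' τ))
      (bound := fun _ => M.T * (M.Rmax * Real.exp (M.T * (L₁ * ε)) * (M.T * L₁)))
      (Metric.ball_mem_nhds θ hε) ?_ ?_ ?_ ?_ (integrable_const _) ?_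
    · filter_upwards [Metric.ball_mem_nhds θ hε] with θ' hθ'
      exact (Finset.measurable_sum _ fun t _ => hcwm t θ' (hball hθ')).aestronglyMeasurable
    · exact integrable_finsetSum _ fun t _ => hcwint t θ (Metric.mem_ball_self hε)
    · simp_rw [hgθ]
      exact (LinearIsometryEquiv.continuous _).comp_aestronglyMeasurable hgint.1
    · refine Filter.Eventually.of_forall fun τ θ' hθ' => ?_
      rw [LinearIsometryEquiv.norm_map]
      calc _ ≤ ∑ _t : Fin M.T, M.Rmax * Real.exp (M.T * (L₁ * ε)) * (M.T * L₁) := by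
            refine norm_sum_le_of_le _ fun t _ => ?_
            rw [norm_smul]
            exact mul_le_mul (hcwle t θ' hθ' τ) (pol.norm_sum_score_le M hL₁.le
              (fun s a => (hreg θ' (hball hθ') s a).2.2.2.1) _ τ) (norm_nonneg _)
              ((norm_nonneg _).trans (hcwle t θ' hθ' τ))
        _ = _ := by simp
    · refine Filter.Eventually.of_forall fun τ θ' hθ' => ?_
      have h1 : HasFDerivAt (fun θ' => ∑ t, c t τ * w t θ' τ)
          (∑ t, c t τ • (w t θ' τ • ∑ l ∈ e.steps t,
            InnerProductSpace.toDual ℝ _ (pol.score θ' (τ l).1 (τ l).2))) θ' :=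
        HasFDerivAt.fun_sum fun t _ => ((HasFDerivAt.fun_sum fun l _ =>
          (hdlog θ' (hball hθ') _ _).sub_const _).exp).const_mul _
      refine h1.congr_fderiv ?_
      simp [g, map_sum, smul_smul]
  have hJ : pol.J M =ᶠ[nhds θ] fun θ' => ∫ τ, F θ' τ ∂pol.trajLaw M θ := by
    -- Near `θ`, `J` is an integral against the fixed law `p_θ`, so only the integrand is
    -- differentiated.
    filter_upwards [Metric.ball_mem_nhds θ hε] with θ' hθ'
    exact pol.J_eq_integral M hpos hθ (hball hθ') e fun t => hcwint t θ' hθ'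
  rw [hasGradientAt_iff_hasFDerivAt]
  refine (hF.congr_of_eventuallyEq hJ).congr_fderiv ?_
  simp_rw [hgθ]
  ext v
  have hdual : Integrable (fun τ => InnerProductSpace.toDual ℝ (EuclideanSpace ℝ (Fin d))
      (pol.singleEstim M e θ τ)) (pol.trajLaw M θ) :=
    hgint.mono ((LinearIsometryEquiv.continuous _).comp_aestronglyMeasurable hgint.1)
      (by simp)
  rw [ContinuousLinearMap.integral_apply hdual, InnerProductSpace.toDual_apply_apply,
    real_inner_comm, ← integral_inner hgint]
  refine integral_congr_ae (Filter.Eventually.of_forall fun τ => ?_)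
  simp [real_inner_comm]

end PolicyGradient

/-! ### Exponential moment of one term. -/

/-- Second-order bound for the exponential of a power-mean weighted bounded variable. -/
lemma exp_powerMean_le {l G ρ X : ℝ} (hG : 0 < G) (hX : |X| ≤ G) (hl : 0 < l) (hl1 : l ≤ 1)
    (hρ : 0 < ρ) :
    Real.exp (l / G * (1 / ((1 - l) * ρ⁻¹ + l) * X)) ≤
      1 + (l / G * (ρ * X) + (l ^ 2 * (ρ ^ 2 - ρ + 1) + l ^ 2 * ((1 - l) * ρ ^ 2 + l))) := by
  set W : ℝ := 1 / ((1 - l) * ρ⁻¹ + l) with hW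
  have hWle : W ≤ 1 / l := powerMean_weight_le_inv hl hl1 (inv_pos.2 hρ)
  have hWsq : W ^ 2 ≤ (1 - l) * ρ ^ 2 + l := powerMean_weight_sq_le hl hl1 hρ
  have hWb : |W - ρ| ≤ l * (ρ ^ 2 - ρ + 1) :=
    abs_powerMean_weight_sub_le hl hl1 hρ
  have hW0 : 0 ≤ W := by
    have := mul_nonneg (sub_nonneg.2 hl1) (inv_pos.2 hρ).le
    positivity
  have hXG : |X / G| ≤ 1 := by rw [abs_div, abs_of_pos hG]; exact div_le_one_of_le₀ (hX) hG.le
  have hre : l / G * (W * X) = l * W * (X / G) := by field_simp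
  have hre' : l / G * (ρ * X) = l * ρ * (X / G) := by field_simp
  -- The cap `W ≤ 1 / l` keeps the exponent in `[-1, 1]`, where `|e^y - 1 - y| ≤ y²`.
  have hlW : l * W ≤ 1 := by
    calc l * W ≤ l * (1 / l) := by gcongr
      _ = 1 := by field_simp
  have habs : |l * W * (X / G)| ≤ 1 := by
    rw [abs_mul, abs_of_nonneg (by positivity)]
    exact mul_le_one₀ hlW (abs_nonneg _) hXG
  have hexp := (abs_le.1 (Real.abs_exp_sub_one_sub_id_le habs)).2
  have hsq : (l * W * (X / G)) ^ 2 ≤ l ^ 2 * ((1 - l) * ρ ^ 2 + l) := by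
    have h1 : (X / G) ^ 2 ≤ 1 := (sq_le_one_iff_abs_le_one _).2 hXG
    calc _ = l ^ 2 * (W ^ 2 * (X / G) ^ 2) := by ring
      _ ≤ l ^ 2 * W ^ 2 := by
        refine mul_le_mul_of_nonneg_left (mul_le_of_le_one_right (sq_nonneg _) h1) (sq_nonneg _)
      _ ≤ _ := by gcongr
  -- The linear term is moved from `W` to `ρ`, whose product with `X` has the desired mean; the bias
  -- is of order `l²`, like the quadratic term.
  have hlin : l * W * (X / G) - l * ρ * (X / G) ≤ l ^ 2 * (ρ ^ 2 - ρ + 1) := by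
    calc _ = l * ((W - ρ) * (X / G)) := by ring
      _ ≤ l * (|W - ρ| * 1) := by
        refine mul_le_mul_of_nonneg_left ((le_abs_self _).trans ?_) hl.le
        rw [abs_mul]
        gcongr
      _ ≤ l * (l * (ρ ^ 2 - ρ + 1)) := by rw [mul_one]; gcongr
      _ = _ := by ring
  rw [hre, hre']
  linarith

/-- Exponential moment of a power-mean weighted bounded variable around its unweighted mean. -/
lemma integral_exp_powerMean_sub_le {Y : Type*} [MeasurableSpace Y] {P : Measure Y}
    [IsProbabilityMeasure P] {ρ X : Y → ℝ} {l G D : ℝ} (hG : 0 < G) (hX : ∀ τ, |X τ| ≤ G)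
    (hl : 0 < l) (hl1 : l ≤ 1) (hρ : ∀ τ, 0 < ρ τ) (hD : 1 ≤ D)
    (hρsq : Integrable (fun τ => ρ τ ^ 2) P) (hρsqle : ∫ τ, ρ τ ^ 2 ∂P ≤ D)
    (hρint : Integrable ρ P) (hρone : ∫ τ, ρ τ ∂P = 1)
    (hρX : Integrable (fun τ => ρ τ * X τ) P) (hρm : Measurable ρ) (hXm : Measurable X) :
    Integrable (fun τ =>
      Real.exp (l / G * (1 / ((1 - l) * (ρ τ)⁻¹ + l) * X τ - ∫ τ, ρ τ * X τ ∂P))) P ∧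
    ∫ τ, Real.exp (l / G * (1 / ((1 - l) * (ρ τ)⁻¹ + l) * X τ - ∫ τ, ρ τ * X τ ∂P)) ∂P ≤
      Real.exp (2 * l ^ 2 * D) := by
  set m := ∫ τ, ρ τ * X τ ∂P with hm
  have hpt : ∀ τ, Real.exp (l / G * (1 / ((1 - l) * (ρ τ)⁻¹ + l) * X τ - m)) ≤
      (1 + (l / G * (ρ τ * X τ) + (l ^ 2 * (ρ τ ^ 2 - ρ τ + 1) +
        l ^ 2 * ((1 - l) * ρ τ ^ 2 + l)))) * Real.exp (-(l / G * m)) := by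
    intro τ
    rw [mul_sub, sub_eq_add_neg, Real.exp_add]
    exact mul_le_mul_of_nonneg_right (exp_powerMean_le hG (hX τ) hl hl1 (hρ τ))
      (Real.exp_pos _).le
  have hA : Integrable (fun τ => l / G * (ρ τ * X τ)) (P) := hρX.const_mul _
  have hB : Integrable (fun τ => l ^ 2 * (ρ τ ^ 2 - ρ τ + 1)) (P) :=
    ((hρsq.sub hρint).add (integrable_const 1)).const_mul _
  have hC : Integrable (fun τ => l ^ 2 * ((1 - l) * ρ τ ^ 2 + l)) (P) :=
    ((hρsq.const_mul _).add (integrable_const l)).const_mul _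
  have hBC : Integrable (fun τ => l ^ 2 * (ρ τ ^ 2 - ρ τ + 1) +
      l ^ 2 * ((1 - l) * ρ τ ^ 2 + l)) P := hB.add hC
  have hABC : Integrable (fun τ => l / G * (ρ τ * X τ) + (l ^ 2 * (ρ τ ^ 2 - ρ τ + 1) +
      l ^ 2 * ((1 - l) * ρ τ ^ 2 + l))) P := hA.add hBC
  have hsub : Integrable (fun τ => ρ τ ^ 2 - ρ τ) P := hρsq.sub hρint
  have hall := (integrable_const (μ := P) (1 : ℝ)).add hABC
  constructor
  · refine (hall.mul_const (Real.exp (-(l / G * m)))).mono' ?_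
      (Filter.Eventually.of_forall fun τ => ?_)
    · have : Measurable fun τ => Real.exp (l / G * (1 / ((1 - l) * (ρ τ)⁻¹ + l) * X τ - m)) := by
        fun_prop
      exact this.aestronglyMeasurable
    · rw [Real.norm_of_nonneg (Real.exp_pos _).le]
      exact hpt τ
  calc _ ≤ ∫ τ, (1 + (l / G * (ρ τ * X τ) + (l ^ 2 * (ρ τ ^ 2 - ρ τ + 1) +
        l ^ 2 * ((1 - l) * ρ τ ^ 2 + l)))) * Real.exp (-(l / G * m)) ∂P :=
        integral_mono_of_nonneg (Filter.Eventually.of_forall fun _ => (Real.exp_pos _).le)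
          (hall.mul_const _) (Filter.Eventually.of_forall hpt)
    -- As `ρ` has mean one, `ρ² - ρ + 1` integrates to the second moment alone.
    _ = (1 + (l / G * m + (l ^ 2 * (∫ τ, ρ τ ^ 2 ∂P) +
        l ^ 2 * ((1 - l) * (∫ τ, ρ τ ^ 2 ∂P) + l)))) *
          Real.exp (-(l / G * m)) := by
        rw [integral_mul_const, integral_add (integrable_const _) hABC, integral_add hA hBC,
          integral_add hB hC, integral_const_mul, ← hm, integral_const_mul, integral_const_mul,
          integral_add hsub (integrable_const _), integral_sub hρsq hρint, hρone,
          integral_add (hρsq.const_mul _) (integrable_const _), integral_const_mul]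
        simp
    _ ≤ (l / G * m + 2 * l ^ 2 * D + 1) * Real.exp (-(l / G * m)) := by
        refine mul_le_mul_of_nonneg_right ?_ (Real.exp_pos _).le
        have h1 : l ^ 2 * (∫ τ, ρ τ ^ 2 ∂P) ≤ l ^ 2 * D := by gcongr
        -- Here `D ≥ 1` absorbs the summand `l`.
        have h2 : l ^ 2 * ((1 - l) * (∫ τ, ρ τ ^ 2 ∂P) + l) ≤ l ^ 2 * D := by
          refine mul_le_mul_of_nonneg_left ?_ (sq_nonneg _)
          nlinarith [mul_le_mul_of_nonneg_left hρsqle (sub_nonneg.2 hl1)]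
        linarith
    -- By `1 + u ≤ e^u` the mean term cancels against the centring factor.
    _ ≤ Real.exp (l / G * m + 2 * l ^ 2 * D) * Real.exp (-(l / G * m)) :=
        mul_le_mul_of_nonneg_right (Real.add_one_le_exp _) (Real.exp_pos _).le
    _ = _ := by rw [← Real.exp_add]; congr 1; ring

section ExponentialMoment

variable {S A : Type*} [MeasurableSpace S] [MeasurableSpace A]
  {d : ℕ} {Θ : Set (EuclideanSpace ℝ (Fin d))} {ν : Measure A}
  {pol : Policy S Θ ν}

lemma Policy.ratio_pos (hpos : ∀ θ ∈ Θ, ∀ s a, 0 < pol.dens θ s a) (M : MDP S A)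
    {θ θ' : EuclideanSpace ℝ (Fin d)} (hθ : θ ∈ Θ) (hθ' : θ' ∈ Θ) (τ : M.Traj) :
    0 < pol.ratio M θ θ' τ :=
  Finset.prod_pos fun _ _ => div_pos (hpos _ hθ _ _) (hpos _ hθ' _ _)

lemma Policy.ratio_eq_inv (M : MDP S A) (θ θ' : EuclideanSpace ℝ (Fin d)) (τ : M.Traj) :
    pol.ratio M θ' θ τ = (pol.ratio M θ θ' τ)⁻¹ := by
  rw [ratio, ratio, ← Finset.prod_inv_distrib]
  exact Finset.prod_congr rfl fun _ _ => (inv_div _ _).symm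

variable [SigmaFinite ν] {M : MDP S A}

/-- The likelihood ratio is the Radon–Nikodym derivative, so its second moment is at most `1 + (D -
1)`. The divergence assumption enters the proof only here. -/
lemma Policy.lintegral_ratio_sq_le (hpos : ∀ θ ∈ Θ, ∀ s a, 0 < pol.dens θ s a) {D : ℝ}
    (hD : 1 ≤ D) (hchi : pol.ChiSqBounded M D)
    {θ θ' : EuclideanSpace ℝ (Fin d)} (hθ : θ ∈ Θ) (hθ' : θ' ∈ Θ) :
    ∫⁻ τ, ENNReal.ofReal (pol.ratio M θ θ' τ ^ 2) ∂pol.trajLaw M θ' ≤ ENNReal.ofReal D := by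
  have := pol.isProbabilityMeasure_trajLaw M hθ'
  have hrm : Measurable fun τ => ENNReal.ofReal (pol.ratio M θ θ' τ) :=
    (pol.measurable_prod_stepRatio M hθ' hθ Finset.univ).ennreal_ofReal
  have hwd := trajLaw_eq_withDensity M hpos hθ' hθ
  have hac : pol.trajLaw M θ ≪ pol.trajLaw M θ' := by
    rw [hwd]; exact withDensity_absolutelyContinuous _ _
  have h := hchi θ hθ θ' hθ'
  have hrn : (pol.trajLaw M θ).rnDeriv (pol.trajLaw M θ') =ᵐ[pol.trajLaw M θ']
      fun τ => ENNReal.ofReal (pol.ratio M θ θ' τ) := by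
    conv_lhs => rw [hwd]
    exact Measure.rnDeriv_withDensity _ hrm
  rw [chiSq, if_pos hac, tsub_le_iff_right] at h
  calc _ = ∫⁻ τ, (pol.trajLaw M θ).rnDeriv (pol.trajLaw M θ') τ ^ 2 ∂pol.trajLaw M θ' := by
        refine lintegral_congr_ae ?_
        filter_upwards [hrn] with τ hτ
        rw [hτ, ENNReal.ofReal_pow (ratio_pos hpos M hθ hθ' τ).le]
    _ ≤ _ := h
    _ = ENNReal.ofReal D := by
        rw [← ENNReal.ofReal_one, ← ENNReal.ofReal_add (by linarith) zero_le_one]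
        congr 1; ring

lemma Policy.integrable_ratio_sq (hpos : ∀ θ ∈ Θ, ∀ s a, 0 < pol.dens θ s a) {D : ℝ}
    (hD : 1 ≤ D) (hchi : pol.ChiSqBounded M D)
    {θ θ' : EuclideanSpace ℝ (Fin d)} (hθ : θ ∈ Θ) (hθ' : θ' ∈ Θ) :
    Integrable (fun τ => pol.ratio M θ θ' τ ^ 2) (pol.trajLaw M θ') := by
  have hrm : Measurable fun τ => pol.ratio M θ θ' τ ^ 2 :=
    (pol.measurable_prod_stepRatio M hθ' hθ Finset.univ).pow_const 2
  refine ⟨hrm.aestronglyMeasurable, ?_⟩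
  rw [hasFiniteIntegral_iff_ofReal (Filter.Eventually.of_forall fun τ => sq_nonneg _)]
  exact (lintegral_ratio_sq_le hpos hD hchi hθ hθ').trans_lt ENNReal.ofReal_lt_top

lemma Policy.integral_ratio_sq_le (hpos : ∀ θ ∈ Θ, ∀ s a, 0 < pol.dens θ s a) {D : ℝ}
    (hD : 1 ≤ D) (hchi : pol.ChiSqBounded M D)
    {θ θ' : EuclideanSpace ℝ (Fin d)} (hθ : θ ∈ Θ) (hθ' : θ' ∈ Θ) :
    ∫ τ, pol.ratio M θ θ' τ ^ 2 ∂pol.trajLaw M θ' ≤ D := by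
  rw [integral_eq_lintegral_of_nonneg_ae (Filter.Eventually.of_forall fun τ => sq_nonneg _)
    (integrable_ratio_sq hpos hD hchi hθ hθ').1]
  exact ENNReal.toReal_le_of_le_ofReal (by linarith)
    (lintegral_ratio_sq_le hpos hD hchi hθ hθ')

lemma Policy.integral_ratio_mul (hpos : ∀ θ ∈ Θ, ∀ s a, 0 < pol.dens θ s a)
    {θ θ' : EuclideanSpace ℝ (Fin d)} (hθ : θ ∈ Θ) (hθ' : θ' ∈ Θ) (h : M.Traj → ℝ) :
    ∫ τ, pol.ratio M θ θ' τ * h τ ∂pol.trajLaw M θ' = ∫ τ, h τ ∂pol.trajLaw M θ := by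
  have hrm : Measurable fun τ => ENNReal.ofReal (pol.ratio M θ θ' τ) :=
    (pol.measurable_prod_stepRatio M hθ' hθ Finset.univ).ennreal_ofReal
  rw [trajLaw_eq_withDensity M hpos hθ' hθ,
    integral_withDensity_eq_integral_toReal_smul hrm (by simp)]
  refine integral_congr_ae (Filter.Eventually.of_forall fun τ => ?_)
  simp [ENNReal.toReal_ofReal (ratio_pos hpos M hθ hθ' τ).le]

/-- Exponential moment of the error of a single power-mean importance-weighted term. -/
theorem Policy.integral_exp_powerMean_le (hΘ : IsOpen Θ) (hreg : pol.LogRegular)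
    (e : EstimatorKind) {D : ℝ} (hD : 1 ≤ D) (hchi : pol.ChiSqBounded M D)
    {θ θ' : EuclideanSpace ℝ (Fin d)} (hθ : θ ∈ Θ) (hθ' : θ' ∈ Θ) {G l : ℝ} (hG : 0 < G)
    (hbound : ∀ τ, ‖pol.singleEstim M e θ τ‖ ≤ G) (hl : 0 < l) (hl1 : l ≤ 1)
    {v : EuclideanSpace ℝ (Fin d)} (hv : ‖v‖ ≤ 1) :
    Integrable (fun τ => Real.exp (l / G * inner ℝ v ((1 / ((1 - l) * pol.ratio M θ' θ τ + l)) •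
      pol.singleEstim M e θ τ - gradient (pol.J M) θ))) (pol.trajLaw M θ') ∧
    ∫ τ, Real.exp (l / G * inner ℝ v ((1 / ((1 - l) * pol.ratio M θ' θ τ + l)) •
      pol.singleEstim M e θ τ - gradient (pol.J M) θ)) ∂pol.trajLaw M θ' ≤
      Real.exp (2 * l ^ 2 * D) := by
  have hgrad := (pol.hasGradientAt_J M hΘ hreg e hθ).gradient
  have hgint := pol.integrable_singleEstim M hΘ hreg e hθ
  obtain ⟨L₁, hL₁, L₂, -, hreg⟩ := hreg
  have hpos : ∀ θ ∈ Θ, ∀ s a, 0 < pol.dens θ s a := fun θ hθ s a => (hreg θ hθ s a).1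
  have hprob := pol.isProbabilityMeasure_trajLaw M hθ'
  have hprobθ := pol.isProbabilityMeasure_trajLaw M hθ
  set m : ℝ := inner ℝ v (gradient (pol.J M) θ) with hm
  let ρ : M.Traj → ℝ := fun τ => pol.ratio M θ θ' τ
  let X : M.Traj → ℝ := fun τ => inner ℝ v (pol.singleEstim M e θ τ)
  have hρpos : ∀ τ, 0 < ρ τ := ratio_pos hpos M hθ hθ'
  have hX : ∀ τ, |X τ| ≤ G := fun τ => (abs_real_inner_le_norm _ _).trans
    ((mul_le_of_le_one_left (norm_nonneg _) hv).trans (hbound τ))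
  have hXmean : ∫ τ, ρ τ * X τ ∂pol.trajLaw M θ' = m := by
    rw [integral_ratio_mul hpos hθ hθ', hm, hgrad, integral_inner hgint]
  have hρsq := integrable_ratio_sq hpos hD hchi hθ hθ'
  have hρsqle := integral_ratio_sq_le hpos hD hchi hθ hθ'
  have hρmeas : Measurable ρ := pol.measurable_prod_stepRatio M hθ' hθ Finset.univ
  -- Domination by `ρ ≤ ρ² + 1`.
  have hρint : Integrable ρ (pol.trajLaw M θ') := by
    refine (hρsq.add (integrable_const 1)).mono' hρmeas.aestronglyMeasurable
      (Filter.Eventually.of_forall fun τ => ?_)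
    rw [Real.norm_of_nonneg (hρpos τ).le]
    simp only [Pi.add_apply]
    nlinarith [sq_nonneg (ρ τ - 1), hρpos τ]
  have hρone : ∫ τ, ρ τ ∂pol.trajLaw M θ' = 1 := by
    have := integral_ratio_mul (pol := pol) (M := M) hpos hθ hθ' (fun _ => 1)
    simpa using this
  have hXm : Measurable X := measurable_const.inner
    ((pol.measurable_singleEstim hΘ (fun θ hθ s a => (hreg θ hθ s a).2.1) M e).comp
      (measurable_prodMk_left (x := (⟨θ, hθ⟩ : Θ))))
  have hρX : Integrable (fun τ => ρ τ * X τ) (pol.trajLaw M θ') :=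
    hρint.mul_bdd (c := G) hXm.aestronglyMeasurable (Filter.Eventually.of_forall hX)
  have h := integral_exp_powerMean_sub_le hG hX hl hl1 hρpos hD hρsq hρsqle hρint hρone hρX
    hρmeas hXm
  rw [hXmean] at h
  have heq : ∀ τ, inner ℝ v ((1 / ((1 - l) * pol.ratio M θ' θ τ + l)) •
      pol.singleEstim M e θ τ - gradient (pol.J M) θ) =
      1 / ((1 - l) * (ρ τ)⁻¹ + l) * X τ - m := fun τ => by
    rw [ratio_eq_inv M θ θ' τ, inner_sub_right, real_inner_smul_right]
  simp_rw [heq]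
  exact h

end ExponentialMoment

/-! ### Adaptive histories: integrating out one batch after another. -/

/-- If, conditionally on `m`, the variable `τ` has law `κ θ` with `θ` being `m`-measurable, then
a factor whose `κ`-integral is at most `C` can be integrated out. -/
lemma lintegral_mul_le_of_condLaw {Ω Y B : Type*} [MeasurableSpace Y] [MeasurableSpace B]
    {m mΩ : MeasurableSpace Ω} (hm : m ≤ mΩ) {μ : Measure Ω} [IsProbabilityMeasure μ]
    {θ : Ω → Y} (hθ : Measurable[m] θ) {τ : Ω → B} (hτ : Measurable τ)
    (κ : Kernel Y B) [IsMarkovKernel κ]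
    (hcond : ∀ t : Set B, MeasurableSet t →
      μ⟦τ ⁻¹' t | m⟧ =ᵐ[μ] fun ω => (κ (θ ω)).real t)
    {W : Ω → ENNReal} (hW : Measurable[m] W) {F : Y × B → ENNReal} (hF : Measurable F)
    {C : ENNReal} (hC : ∀ y, ∫⁻ b, F (y, b) ∂κ y ≤ C) :
    ∫⁻ ω, W ω * F (θ ω, τ ω) ∂μ ≤ C * ∫⁻ ω, W ω ∂μ := by
  have hθ' : Measurable θ := hθ.mono hm le_rfl
  have hW' : Measurable W := hW.mono hm le_rfl
  have hX : Measurable[m] fun ω => (W ω, θ ω) := Measurable.prodMk hW hθ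
  have hX' : Measurable fun ω => (W ω, θ ω) := hW'.prodMk hθ'
  -- The defining property of conditional expectation, tested on `m`-measurable sets.
  have hset : ∀ s, MeasurableSet[m] s → ∀ t, MeasurableSet t →
      μ (s ∩ τ ⁻¹' t) = ∫⁻ ω in s, κ (θ ω) t ∂μ := by
    intro s hs t ht
    have hreal : Measurable fun ω => (κ (θ ω)).real t :=
      ((κ.measurable_coe ht).comp hθ').ennreal_toReal
    have hint : Integrable (fun ω => (κ (θ ω)).real t) μ :=
      Integrable.of_bound hreal.aestronglyMeasurable 1 (Filter.Eventually.of_forall fun ω => by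
        rw [Real.norm_of_nonneg measureReal_nonneg]; exact measureReal_le_one)
    have h1 : ∫ ω in s, (κ (θ ω)).real t ∂μ = μ.real (s ∩ τ ⁻¹' t) := by
      rw [← setIntegral_congr_ae (hm s hs) ((hcond t ht).mono fun ω h _ => h),
        setIntegral_condExp hm ((integrable_const (1 : ℝ)).indicator (hτ ht)) hs,
        integral_indicator (hτ ht), Measure.restrict_restrict (hτ ht)]
      simp [Set.inter_comm]
    rw [← ofReal_measureReal, ← h1, ofReal_integral_eq_lintegral_ofReal hint.integrableOn
      (Filter.Eventually.of_forall fun ω => measureReal_nonneg)]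
    simp [ofReal_measureReal]
  -- Only `(W, θ)` is retained from the past. The joint law with `τ` is identified on rectangles,
  -- with no regular conditional distribution on `Ω`.
  have hmap : μ.map (fun ω => ((W ω, θ ω), τ ω)) =
      (μ.map fun ω => (W ω, θ ω)) ⊗ₘ (Kernel.prodMkLeft ENNReal κ) := by
    have : IsProbabilityMeasure (μ.map (fun ω => ((W ω, θ ω), τ ω))) :=
      Measure.isProbabilityMeasure_map (hX'.prodMk hτ).aemeasurable
    have : IsProbabilityMeasure (μ.map (fun ω => (W ω, θ ω))) :=
      Measure.isProbabilityMeasure_map hX'.aemeasurable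
    refine Measure.ext_prod fun {s t} hs ht => ?_
    rw [Measure.map_apply (hX'.prodMk hτ) (hs.prod ht), Measure.compProd_apply_prod hs ht,
      setLIntegral_map hs (Kernel.measurable_coe _ ht) hX']
    exact hset _ (hX hs) t ht
  have hG : Measurable fun z : (ENNReal × Y) × B => z.1.1 * F (z.1.2, z.2) :=
    measurable_fst.fst.mul (hF.comp (measurable_fst.snd.prodMk measurable_snd))
  calc ∫⁻ ω, W ω * F (θ ω, τ ω) ∂μ
      = ∫⁻ z, z.1.1 * F (z.1.2, z.2) ∂μ.map (fun ω => ((W ω, θ ω), τ ω)) :=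
        (lintegral_map hG (hX'.prodMk hτ)).symm
    _ = ∫⁻ x, ∫⁻ b, x.1 * F (x.2, b) ∂κ x.2 ∂μ.map (fun ω => (W ω, θ ω)) := by
        have : IsProbabilityMeasure (μ.map (fun ω => (W ω, θ ω))) :=
          Measure.isProbabilityMeasure_map hX'.aemeasurable
        rw [hmap, Measure.lintegral_compProd hG]
        rfl
    _ ≤ ∫⁻ x, C * x.1 ∂μ.map (fun ω => (W ω, θ ω)) := by
        refine lintegral_mono fun x => ?_
        simp only
        rw [lintegral_const_mul (f := fun b => F (x.2, b)) _ (hF.comp measurable_prodMk_left),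
          mul_comm]
        exact mul_le_mul_left (hC x.2) _
    _ = C * ∫⁻ ω, W ω ∂μ := by
        rw [lintegral_map (measurable_fst.const_mul C) hX', lintegral_const_mul _ hW']

section Batches

variable {S A : Type*} [MeasurableSpace S] [MeasurableSpace A]
  {d : ℕ} {Θ : Set (EuclideanSpace ℝ (Fin d))} {ν : Measure A} [SigmaFinite ν]
  {pol : Policy S Θ ν} {M : MDP S A}

/-- Positivity allows all laws to be written with densities against the law at one fixed `θ₀`, and
these densities are jointly measurable in parameter and trajectory. -/
lemma Policy.measurable_trajLaw (hpos : ∀ θ ∈ Θ, ∀ s a, 0 < pol.dens θ s a) :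
    Measurable fun θ : Θ => pol.trajLaw M θ := by
  rcases isEmpty_or_nonempty Θ with hE | ⟨⟨θ₀⟩⟩
  · exact measurable_of_empty _
  have := pol.isProbabilityMeasure_trajLaw M θ₀.2
  refine Measure.measurable_of_measurable_coe _ fun B hB => ?_
  have h : ∀ θ : Θ, pol.trajLaw M θ B =
      ∫⁻ τ in B, ENNReal.ofReal (pol.ratio M θ θ₀ τ) ∂pol.trajLaw M θ₀ := fun θ => by
    rw [trajLaw_eq_withDensity M hpos θ₀.2 θ.2, withDensity_apply _ hB]
  simp_rw [h]
  exact Measurable.lintegral_prod_right' (f := fun x : Θ × M.Traj =>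
    ENNReal.ofReal (pol.ratio M x.1 θ₀ x.2)) ((pol.measurable_ratio M).comp
      (measurable_fst.prodMk (measurable_const.prodMk measurable_snd))).ennreal_ofReal

/-- The law of a batch of `N` independent trajectories, as a kernel in the parameter. -/
noncomputable def Policy.batchKernel (pol : Policy S Θ ν) (M : MDP S A)
    (hpos : ∀ θ ∈ Θ, ∀ s a, 0 < pol.dens θ s a) (N : ℕ) : Kernel Θ (Fin N → M.Traj) where
  toFun θ := Measure.pi fun _ => pol.trajLaw M θ
  measurable' := by
    have (θ : Θ) : IsProbabilityMeasure (pol.trajLaw M θ) :=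
      pol.isProbabilityMeasure_trajLaw M θ.2
    refine Measurable.measure_of_isPiSystem_of_isProbabilityMeasure generateFrom_pi.symm
      isPiSystem_pi ?_
    rintro - ⟨s, hs, rfl⟩
    simp_rw [Measure.pi_pi]
    refine Finset.measurable_prod _ fun j _ => ?_
    have hsj : MeasurableSet (s j) := hs j (Set.mem_univ j)
    exact (Measure.measurable_coe hsj).comp (measurable_trajLaw hpos)

instance Policy.isMarkovKernel_batchKernel (hpos : ∀ θ ∈ Θ, ∀ s a, 0 < pol.dens θ s a)
    (N : ℕ) : IsMarkovKernel (pol.batchKernel M hpos N) := by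
  have (θ : Θ) : IsProbabilityMeasure (pol.trajLaw M θ) := pol.isProbabilityMeasure_trajLaw M θ.2
  refine ⟨fun θ => ?_⟩
  change IsProbabilityMeasure (Measure.pi fun _ => pol.trajLaw M θ)
  infer_instance

variable {Ω : Type*} [mΩ : MeasurableSpace Ω] {μ : Measure Ω} [IsProbabilityMeasure μ]
  {N k : ℕ} {θs : ℕ → Ω → Θ} {τs : ℕ → Ω → Fin N → M.Traj}

/-- Multiplicative functionals of a history have product moment bounds. -/
lemma IsHistory.lintegral_prod_le (hist : IsHistory pol M μ k θs τs)
    (hpos : ∀ θ ∈ Θ, ∀ s a, 0 < pol.dens θ s a)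
    {F : Θ × (Fin N → M.Traj) → ENNReal} (hF : Measurable F) {C : ENNReal}
    (hC : ∀ θ : Θ, ∫⁻ b, F (θ, b) ∂(Measure.pi fun _ => pol.trajLaw M θ) ≤ C)
    {i₀ : ℕ} (hi₀ : 1 ≤ i₀) (n : ℕ) (hn : i₀ + n ≤ k + 1) :
    ∫⁻ ω, ∏ i ∈ Finset.Ico i₀ (i₀ + n), F (θs i ω, τs i ω) ∂μ ≤ C ^ n := by
  induction n with
  | zero => simp
  | succ n ih =>
    have hi : i₀ + n ∈ Finset.Icc 1 k := Finset.mem_Icc.2 ⟨by omega, by omega⟩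
    have hθm : ∀ i ∈ Finset.Icc 1 (i₀ + n), Measurable[pastSigma θs τs (i₀ + n)] (θs i) :=
      fun i hi => measurable_iff_comap_le.2
        ((le_iSup₂ (f := fun l (_ : l ∈ Finset.Icc 1 (i₀ + n)) =>
          MeasurableSpace.comap (θs l) inferInstance) i hi).trans le_sup_left)
    have hτm : ∀ i ∈ Finset.Ico 1 (i₀ + n), Measurable[pastSigma θs τs (i₀ + n)] (τs i) :=
      fun i hi => measurable_iff_comap_le.2
        ((le_iSup₂ (f := fun l (_ : l ∈ Finset.Ico 1 (i₀ + n)) =>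
          MeasurableSpace.comap (τs l) inferInstance) i hi).trans le_sup_right)
    have hle : pastSigma θs τs (i₀ + n) ≤ mΩ := by
      rw [Finset.mem_Icc] at hi
      refine sup_le (iSup₂_le fun l hl => ?_) (iSup₂_le fun l hl => ?_)
      · rw [Finset.mem_Icc] at hl
        exact (hist.measurable_param l (Finset.mem_Icc.2 ⟨by omega, by omega⟩)).comap_le
      · rw [Finset.mem_Ico] at hl
        exact (hist.measurable_batch l (Finset.mem_Icc.2 ⟨by omega, by omega⟩)).comap_le
    have hW : Measurable[pastSigma θs τs (i₀ + n)] fun ω =>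
        ∏ i ∈ Finset.Ico i₀ (i₀ + n), F (θs i ω, τs i ω) := by
      refine Finset.measurable_prod _ fun i hi => ?_
      rw [Finset.mem_Ico] at hi
      exact hF.comp (Measurable.prodMk (hθm i (Finset.mem_Icc.2 ⟨by omega, by omega⟩))
        (hτm i (Finset.mem_Ico.2 ⟨by omega, by omega⟩)))
    rw [← add_assoc]
    simp_rw [Finset.prod_Ico_succ_top (Nat.le_add_right i₀ n)]
    -- The latest batch is integrated out first: all earlier factors are measurable with respect to
    -- its past, so it costs one factor `C`.
    refine (lintegral_mul_le_of_condLaw hle (hθm _ (Finset.mem_Icc.2 ⟨by omega, le_rfl⟩))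
      (hist.measurable_batch _ hi) (pol.batchKernel M hpos N) (hist.cond_law _ hi) hW hF hC).trans ?_
    rw [pow_succ']
    gcongr
    exact ih (by omega)

end Batches

lemma one_le_winStart (w k : ℕ) : 1 ≤ winStart w k := Nat.le_add_left _ _

lemma winStart_add_winSize (w k : ℕ) : winStart w k + winSize w k = k + 1 := by
  have : winSize w k ≤ k := min_le_right _ _
  unfold winStart
  omega

lemma window_eq_Ico (w k : ℕ) :
    Finset.Icc (winStart w k) k = Finset.Ico (winStart w k) (winStart w k + winSize w k) := by
  rw [winStart_add_winSize]
  ext i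
  simp

/-! ### Tail bound at a fixed target. -/

section Deviation

variable {S A : Type*} [MeasurableSpace S] [MeasurableSpace A]
  {d : ℕ} {Θ : Set (EuclideanSpace ℝ (Fin d))} {ν : Measure A} [SigmaFinite ν]

/-- The error of a single power-mean importance-weighted term, sampled under `θ'`. -/
noncomputable def Policy.termError (pol : Policy S Θ ν) (M : MDP S A) (e : EstimatorKind) (l : ℝ)
    (θ θ' : EuclideanSpace ℝ (Fin d)) (τ : M.Traj) : EuclideanSpace ℝ (Fin d) :=
  (1 / ((1 - l) * pol.ratio M θ' θ τ + l)) • pol.singleEstim M e θ τ - gradient (pol.J M) θ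

/-- With constant coefficients the estimator is a plain average of `N ω_k` terms, so the gradient
can be subtracted from each. -/
lemma Policy.mpm_sub_gradient (pol : Policy S Θ ν) (M : MDP S A) (e : EstimatorKind)
    {N w k : ℕ} (hN : 0 < N) (hw : 0 < winSize w k) {α lam : ℕ → ℝ} {l : ℝ}
    (hlam : ∀ i ∈ Finset.Icc (winStart w k) k, lam i = l)
    (hα : ∀ i ∈ Finset.Icc (winStart w k) k, α i = 1 / (winSize w k : ℝ))
    (θs : ℕ → Θ) (τs : ℕ → Fin N → M.Traj) (θ : EuclideanSpace ℝ (Fin d)) :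
    ((N : ℝ) * winSize w k) • (pol.mpm M e w k α lam θs τs θ - gradient (pol.J M) θ) =
      ∑ i ∈ Finset.Icc (winStart w k) k, ∑ j, pol.termError M e l θ (θs i) (τs i j) := by
  have hN' : (N : ℝ) ≠ 0 := by positivity
  have hw' : (winSize w k : ℝ) ≠ 0 := by positivity
  have hcard : (Finset.Icc (winStart w k) k).card = winSize w k := by
    rw [window_eq_Ico]; simp
  simp only [termError, Finset.sum_sub_distrib, Finset.sum_const, Finset.card_univ,
    Fintype.card_fin, hcard, smul_sub, mpm, Finset.smul_sum, smul_smul]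
  congr 1
  · refine Finset.sum_congr rfl fun i hi => Finset.sum_congr rfl fun j _ => ?_
    rw [hlam i hi, hα i hi]
    congr 1
    field_simp
  · rw [← Nat.cast_smul_eq_nsmul ℝ, Nat.cast_mul, mul_comm]

variable {pol : Policy S Θ ν} {M : MDP S A}

lemma Policy.measurable_termError (hΘ : IsOpen Θ) (hreg : pol.LogRegular) (e : EstimatorKind)
    (l : ℝ) (θ : Θ) : Measurable fun x : Θ × M.Traj => pol.termError M e l θ x.1 x.2 := by
  obtain ⟨L₁, -, L₂, -, hreg⟩ := hreg
  have hr : Measurable fun x : Θ × M.Traj => pol.ratio M x.1 θ x.2 :=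
    (pol.measurable_ratio M).comp (measurable_fst.prodMk (measurable_const.prodMk measurable_snd))
  have hg : Measurable fun x : Θ × M.Traj => pol.singleEstim M e θ x.2 :=
    (pol.measurable_singleEstim hΘ (fun θ hθ s a => (hreg θ hθ s a).2.1) M e).comp
      ((measurable_const (a := θ)).prodMk measurable_snd)
  exact (Measurable.smul (measurable_const.div ((hr.const_mul _).add_const _)) hg).sub_const _

/-- Independence inside a batch turns the one-term bound into its `N`-th power, uniformly in the
sampling parameter `θ'`. -/
lemma Policy.lintegral_batch_exp_le (hΘ : IsOpen Θ) (hreg : pol.LogRegular)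
    (e : EstimatorKind) {D : ℝ} (hD : 1 ≤ D) (hchi : pol.ChiSqBounded M D)
    {θ θ' : EuclideanSpace ℝ (Fin d)} (hθ : θ ∈ Θ) (hθ' : θ' ∈ Θ) {G l : ℝ} (hG : 0 < G)
    (hbound : ∀ τ, ‖pol.singleEstim M e θ τ‖ ≤ G) (hl : 0 < l) (hl1 : l ≤ 1)
    {v : EuclideanSpace ℝ (Fin d)} (hv : ‖v‖ ≤ 1) (N : ℕ) :
    ∫⁻ b : Fin N → M.Traj, ENNReal.ofReal (∏ j,
        Real.exp (l / G * inner ℝ v (pol.termError M e l θ θ' (b j))))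
        ∂(Measure.pi fun _ => pol.trajLaw M θ') ≤
      ENNReal.ofReal (Real.exp (N * (2 * l ^ 2 * D))) := by
  have := pol.isProbabilityMeasure_trajLaw M hθ'
  obtain ⟨hint, hle⟩ := integral_exp_powerMean_le hΘ hreg e hD hchi hθ hθ' hG hbound hl hl1 hv
  change Integrable (fun τ => Real.exp (l / G * inner ℝ v (pol.termError M e l θ θ' τ))) _ at hint
  rw [← ofReal_integral_eq_lintegral_ofReal (Integrable.fintype_prod fun _ => hint)
    (Filter.Eventually.of_forall fun b => Finset.prod_nonneg fun j _ => (Real.exp_pos _).le)]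
  refine ENNReal.ofReal_le_ofReal ?_
  rw [Real.exp_nat_mul]
  refine (integral_fintype_prod_eq_pow (ι := Fin N) (μ := pol.trajLaw M θ')
    fun τ => Real.exp (l / G * inner ℝ v (pol.termError M e l θ θ' τ))).le.trans ?_
  rw [Fintype.card_fin]
  exact pow_le_pow_left₀ (integral_nonneg fun _ => (Real.exp_pos _).le) hle N

variable {Ω : Type*} [mΩ : MeasurableSpace Ω] {μ : Measure Ω} [IsProbabilityMeasure μ]
  {N k : ℕ} {θs : ℕ → Ω → Θ} {τs : ℕ → Ω → Fin N → M.Traj}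

/-- Chernoff bound for the summed errors in a fixed direction. -/
lemma IsHistory.measure_inner_sum_ge_le (hist : IsHistory pol M μ k θs τs)
    (hΘ : IsOpen Θ) (hreg : pol.LogRegular)
    (e : EstimatorKind) {D : ℝ} (hD : 1 ≤ D) (hchi : pol.ChiSqBounded M D)
    {θ : EuclideanSpace ℝ (Fin d)} (hθ : θ ∈ Θ) {G l : ℝ} (hG : 0 < G)
    (hbound : ∀ τ, ‖pol.singleEstim M e θ τ‖ ≤ G) (hl : 0 < l) (hl1 : l ≤ 1)
    {v : EuclideanSpace ℝ (Fin d)} (hv : ‖v‖ ≤ 1) (w : ℕ) (x : ℝ) :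
    μ {ω | x ≤ l / G * inner ℝ v (∑ i ∈ Finset.Icc (winStart w k) k, ∑ j,
        pol.termError M e l θ (θs i ω) (τs i ω j))} ≤
      ENNReal.ofReal (Real.exp (N * winSize w k * (2 * l ^ 2 * D) - x)) := by
  have hpos : ∀ θ ∈ Θ, ∀ s a, 0 < pol.dens θ s a := by
    obtain ⟨L₁, -, L₂, -, hreg⟩ := hreg
    exact fun θ hθ s a => (hreg θ hθ s a).1
  let F : Θ × (Fin N → M.Traj) → ENNReal := fun y => ENNReal.ofReal (∏ j,
    Real.exp (l / G * inner ℝ v (pol.termError M e l θ y.1 (y.2 j))))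
  have hF : Measurable F := by
    refine Measurable.ennreal_ofReal (Finset.measurable_prod _ fun j _ => ?_)
    have h := (Policy.measurable_termError (M := M) hΘ hreg e l ⟨θ, hθ⟩).comp
      ((measurable_fst (α := Θ) (β := Fin N → M.Traj)).prodMk
        ((measurable_pi_apply j).comp measurable_snd))
    exact ((measurable_const.inner h).const_mul _).exp
  have hmom := hist.lintegral_prod_le hpos hF
    (fun θ' => Policy.lintegral_batch_exp_le hΘ hreg e hD hchi hθ θ'.2 hG hbound hl hl1 hv N)
    (one_le_winStart w k) (winSize w k) (winStart_add_winSize w k).le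
  rw [← window_eq_Ico] at hmom
  have hprod : ∀ ω, ∏ i ∈ Finset.Icc (winStart w k) k, F (θs i ω, τs i ω) =
      ENNReal.ofReal (Real.exp (l / G * inner ℝ v (∑ i ∈ Finset.Icc (winStart w k) k, ∑ j,
        pol.termError M e l θ (θs i ω) (τs i ω j)))) := by
    intro ω
    rw [← ENNReal.ofReal_prod_of_nonneg
      fun i _ => Finset.prod_nonneg fun j _ => (Real.exp_pos _).le]
    simp_rw [← Real.exp_sum, inner_sum, Finset.mul_sum]
  have hmeas : Measurable fun ω => ∏ i ∈ Finset.Icc (winStart w k) k, F (θs i ω, τs i ω) := by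
    refine Finset.measurable_prod _ fun i hi => ?_
    have hi' : i ∈ Finset.Icc 1 k :=
      Finset.mem_Icc.2 ⟨(one_le_winStart w k).trans (Finset.mem_Icc.1 hi).1,
        (Finset.mem_Icc.1 hi).2⟩
    exact hF.comp ((hist.measurable_param i hi').prodMk (hist.measurable_batch i hi'))
  have hsub : {ω | x ≤ l / G * inner ℝ v (∑ i ∈ Finset.Icc (winStart w k) k, ∑ j,
        pol.termError M e l θ (θs i ω) (τs i ω j))} ⊆
      {ω | ENNReal.ofReal (Real.exp x) ≤
        ∏ i ∈ Finset.Icc (winStart w k) k, F (θs i ω, τs i ω)} := by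
    intro ω hω
    rw [Set.mem_ofPred_eq, hprod]
    exact ENNReal.ofReal_le_ofReal (Real.exp_le_exp.2 hω)
  calc _ ≤ _ := measure_mono hsub
    _ ≤ _ := meas_ge_le_lintegral_div hmeas.aemeasurable
        (ENNReal.ofReal_pos.2 (Real.exp_pos x)).ne' ENNReal.ofReal_ne_top
    _ ≤ ENNReal.ofReal (Real.exp (N * (2 * l ^ 2 * D))) ^ winSize w k /
        ENNReal.ofReal (Real.exp x) := by gcongr
    _ = _ := by
        rw [← ENNReal.ofReal_pow (Real.exp_pos _).le, ← Real.exp_nat_mul,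
          ← ENNReal.ofReal_div_of_pos (Real.exp_pos x), ← Real.exp_sub]
        congr 3
        ring

/-- Deviation bound at a fixed target parameter. -/
theorem IsHistory.measure_mpm_deviation_le (hist : IsHistory pol M μ k θs τs)
    (hΘ : IsOpen Θ) (hreg : pol.LogRegular)
    (e : EstimatorKind) {D : ℝ} (hD : 1 ≤ D) (hchi : pol.ChiSqBounded M D)
    {θ : EuclideanSpace ℝ (Fin d)} (hθ : θ ∈ Θ) {G l δ : ℝ} (hG : 0 < G)
    (hbound : ∀ τ, ‖pol.singleEstim M e θ τ‖ ≤ G) (hδ₀ : 0 < δ) (hδ₁ : δ < 1)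
    (hN : 0 < N) {w : ℕ} (hw : 0 < winSize w k)
    (hl : l = √(4 * (d * Real.log 6 + Real.log (1 / δ)) / (3 * D * N * winSize w k)))
    (hl1 : l ≤ 1) {α lam : ℕ → ℝ}
    (hlam : ∀ i ∈ Finset.Icc (winStart w k) k, lam i = l)
    (hα : ∀ i ∈ Finset.Icc (winStart w k) k, α i = 1 / (winSize w k : ℝ)) :
    μ {ω | 8 * G * √(D * (d * Real.log 6 + Real.log (1 / δ)) / (N * winSize w k)) <
        ‖pol.mpm M e w k α lam (fun i => θs i ω) (fun i => τs i ω) θ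
          - gradient (pol.J M) θ‖} ≤ ENNReal.ofReal δ := by
  set L : ℝ := d * Real.log 6 + Real.log (1 / δ) with hL
  have hL0 : 0 < L := by
    have h1 : 0 < Real.log (1 / δ) := Real.log_pos (by rw [lt_div_iff₀ hδ₀]; linarith)
    have h2 : 0 ≤ (d : ℝ) * Real.log 6 :=
      mul_nonneg (Nat.cast_nonneg d) (Real.log_nonneg (by norm_num))
    linarith
  set n : ℝ := (N : ℝ) * winSize w k with hn
  have hn0 : 0 < n := by positivity
  have hD0 : 0 < D := by linarith
  have hlsq : l ^ 2 = 4 * L / (3 * D * n) := by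
    rw [hl, Real.sq_sqrt (by positivity), hn, mul_assoc (3 * D)]
  have hl0 : 0 < l := by rw [hl]; exact Real.sqrt_pos.2 (by positivity)
  set q : ℝ := √(D * L / n) with hq
  have hqsq : q ^ 2 = D * L / n := Real.sq_sqrt (by positivity)
  -- The left side equals `8/3 L + L`: the moment bound costs `2 l² D n = 8/3 L`, and `L` must
  -- remain. The right side is `8/√3 · L`, which is larger.
  have hlnq : 11 / 3 * L ≤ 4 * (l * n * q) := by
    refine le_of_sq_le_sq ?_ (by positivity)
    have : (4 * (l * n * q)) ^ 2 = 64 / 3 * L ^ 2 := by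
      rw [show (4 * (l * n * q)) ^ 2 = 16 * n ^ 2 * l ^ 2 * q ^ 2 by ring, hlsq, hqsq]
      field_simp
      norm_num
    rw [this]
    nlinarith [sq_nonneg L]
  obtain ⟨V, hVcard, hVnorm, hV⟩ := exists_norming_finset d
  -- Norming vectors have norm at most 2 and are halved to fit the one-direction bound, which turns
  -- the constant 8 into 4.
  have hsub : {ω | 8 * G * q < ‖pol.mpm M e w k α lam (fun i => θs i ω) (fun i => τs i ω) θ
        - gradient (pol.J M) θ‖} ⊆
      ⋃ v ∈ V, {ω | 11 / 3 * L ≤ l / G * inner ℝ ((1 / 2 : ℝ) • v)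
        (∑ i ∈ Finset.Icc (winStart w k) k, ∑ j,
          pol.termError M e l θ (θs i ω) (τs i ω j))} := by
    intro ω hω
    rw [Set.mem_ofPred_eq] at hω
    obtain ⟨v, hv, hle⟩ := hV (pol.mpm M e w k α lam (fun i => θs i ω) (fun i => τs i ω) θ
        - gradient (pol.J M) θ)
    refine Set.mem_biUnion hv ?_
    rw [Set.mem_ofPred_eq, ← pol.mpm_sub_gradient M e hN hw hlam hα, real_inner_smul_left,
      real_inner_smul_right, ← hn]
    have h8 := (hω.trans_le hle).le
    calc 11 / 3 * L ≤ 4 * (l * n * q) := hlnq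
      _ = l / G * (1 / 2 * (n * (8 * G * q))) := by field_simp; ring
      _ ≤ _ := by gcongr
  calc _ ≤ _ := measure_mono hsub
    _ ≤ _ := measure_biUnion_finset_le _ _
    _ ≤ ∑ _v ∈ V, ENNReal.ofReal (Real.exp (-L)) := by
        refine Finset.sum_le_sum fun v hv => ?_
        refine (hist.measure_inner_sum_ge_le hΘ hreg e hD hchi hθ hG hbound hl0 hl1
          (v := (1 / 2 : ℝ) • v) ?_ w _).trans_eq ?_
        · rw [norm_smul, Real.norm_of_nonneg (by norm_num)]
          linarith [hVnorm v hv]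
        · rw [← hn, hlsq]
          congr 2
          field_simp
          ring
    _ = ENNReal.ofReal (V.card * Real.exp (-L)) := by
        rw [Finset.sum_const, nsmul_eq_mul, ENNReal.ofReal_mul (by positivity),
          ENNReal.ofReal_natCast]
    _ ≤ ENNReal.ofReal δ := by
        refine ENNReal.ofReal_le_ofReal ?_
        -- Each direction fails with probability at most `δ / 6 ^ d`, and there are at most `5 ^ d`
        -- of them.
        have hexp : Real.exp (-L) = δ / 6 ^ d := by
          rw [hL, neg_add, Real.exp_add, ← Real.log_inv, one_div, inv_inv, Real.exp_log hδ₀,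
            Real.exp_neg, Real.exp_nat_mul, Real.exp_log (by norm_num)]
          field_simp
        have hc : (V.card : ℝ) ≤ 6 ^ d := by
          calc (V.card : ℝ) ≤ 5 ^ d := by exact_mod_cast hVcard
            _ ≤ 6 ^ d := by gcongr; norm_num
        rw [hexp, mul_div_assoc', div_le_iff₀ (by positivity), mul_comm]
        gcongr

end Deviation

/-! ### Random targets independent of the history. -/

section RandomTarget

variable {S A : Type*} [MeasurableSpace S] [MeasurableSpace A]
  {d : ℕ} {Θ : Set (EuclideanSpace ℝ (Fin d))} {ν : Measure A}

lemma Policy.measurable_mpm {pol : Policy S Θ ν} {M : MDP S A} (hΘ : IsOpen Θ)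
    (hreg : pol.LogRegular) (e : EstimatorKind) {N : ℕ} (w k : ℕ) (α lam : ℕ → ℝ) :
    Measurable fun x : Θ × (ℕ → Θ × (Fin N → M.Traj)) =>
      pol.mpm M e w k α lam (fun i => (x.2 i).1) (fun i => (x.2 i).2) x.1 := by
  obtain ⟨L₁, -, L₂, -, hreg⟩ := hreg
  have hterm : ∀ i j, Measurable fun x : Θ × (ℕ → Θ × (Fin N → M.Traj)) =>
      (α i / ((1 - lam i) * pol.ratio M (x.2 i).1 x.1 ((x.2 i).2 j) + lam i)) •
        pol.singleEstim M e x.1 ((x.2 i).2 j) := by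
    intro i j
    have hi : Measurable fun x : Θ × (ℕ → Θ × (Fin N → M.Traj)) => x.2 i :=
      (measurable_pi_apply i).comp measurable_snd
    have hj : Measurable fun x : Θ × (ℕ → Θ × (Fin N → M.Traj)) => (x.2 i).2 j :=
      (measurable_pi_apply j).comp hi.snd
    have hr : Measurable fun x : Θ × (ℕ → Θ × (Fin N → M.Traj)) =>
        pol.ratio M (x.2 i).1 x.1 ((x.2 i).2 j) :=
      (pol.measurable_ratio M).comp
        (g := fun x : Θ × Θ × M.Traj => pol.ratio M x.1 x.2.1 x.2.2)
        (f := fun x : Θ × (ℕ → Θ × (Fin N → M.Traj)) => ((x.2 i).1, x.1, (x.2 i).2 j))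
        (hi.fst.prodMk (measurable_fst.prodMk hj))
    have hg : Measurable fun x : Θ × (ℕ → Θ × (Fin N → M.Traj)) =>
        pol.singleEstim M e x.1 ((x.2 i).2 j) :=
      (pol.measurable_singleEstim hΘ (fun θ hθ s a => (hreg θ hθ s a).2.1) M e).comp
        (g := fun x : Θ × M.Traj => pol.singleEstim M e x.1 x.2)
        (f := fun x : Θ × (ℕ → Θ × (Fin N → M.Traj)) => (x.1, (x.2 i).2 j))
        (measurable_fst.prodMk hj)
    have hc : Measurable fun x : Θ × (ℕ → Θ × (Fin N → M.Traj)) =>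
        α i / ((1 - lam i) * pol.ratio M (x.2 i).1 x.1 ((x.2 i).2 j) + lam i) :=
      (measurable_const (a := α i)).div ((hr.const_mul (1 - lam i)).add_const (lam i))
    exact hc.smul hg
  unfold Policy.mpm
  fun_prop

lemma measurable_gradient {E : Type*} [NormedAddCommGroup E] [InnerProductSpace ℝ E]
    [CompleteSpace E] [MeasurableSpace E] [BorelSpace E] (f : E → ℝ) :
    Measurable (gradient f) := by
  borelize (StrongDual ℝ E)
  exact (InnerProductSpace.toDual ℝ E).symm.continuous.measurable.comp
    (measurable_fderiv ℝ f)

/-- The window lies in `1, …, k`, so data at other indices may be replaced freely. -/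
lemma Policy.mpm_congr (pol : Policy S Θ ν) (M : MDP S A) (e : EstimatorKind) {N : ℕ} {w k : ℕ}
    (α lam : ℕ → ℝ) {θs θs' : ℕ → Θ} {τs τs' : ℕ → Fin N → M.Traj}
    (h : ∀ i ∈ Finset.Icc 1 k, θs i = θs' i ∧ τs i = τs' i) (θ : EuclideanSpace ℝ (Fin d)) :
    pol.mpm M e w k α lam θs τs θ = pol.mpm M e w k α lam θs' τs' θ := by
  refine Finset.sum_congr rfl fun i hi => ?_
  obtain ⟨h1, h2⟩ := h i (Finset.mem_Icc.2
    ⟨(one_le_winStart w k).trans (Finset.mem_Icc.1 hi).1, (Finset.mem_Icc.1 hi).2⟩)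
  rw [h1, h2]

end RandomTarget

/-- A bound valid for every deterministic value of an independent variable holds at the variable
itself. -/
lemma measure_le_of_indepFun {Ω X Y : Type*} [MeasurableSpace Ω] [MeasurableSpace X]
    [MeasurableSpace Y] {μ : Measure Ω} [IsProbabilityMeasure μ] {f : Ω → X} {g : Ω → Y}
    (hf : Measurable f) (hg : Measurable g) (hfg : IndepFun f g μ) {B : Set (X × Y)}
    (hB : MeasurableSet B) {c : ENNReal} (hc : ∀ x, μ {ω | (x, g ω) ∈ B} ≤ c) :
    μ {ω | (f ω, g ω) ∈ B} ≤ c := by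
  have : IsProbabilityMeasure (μ.map f) := Measure.isProbabilityMeasure_map hf.aemeasurable
  have : IsProbabilityMeasure (μ.map g) := Measure.isProbabilityMeasure_map hg.aemeasurable
  calc μ {ω | (f ω, g ω) ∈ B} = μ.map (fun ω => (f ω, g ω)) B :=
        (Measure.map_apply (hf.prodMk hg) hB).symm
    _ = ∫⁻ x, μ.map g (Prod.mk x ⁻¹' B) ∂μ.map f := by
        rw [(indepFun_iff_map_prod_eq_prod_map_map hf.aemeasurable hg.aemeasurable).1 hfg,
          Measure.prod_apply hB]
    _ ≤ ∫⁻ _x, c ∂μ.map f := by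
        refine lintegral_mono fun x => ?_
        rw [Measure.map_apply hg (measurable_prodMk_left hB)]
        exact hc x
    _ = c := by simp

/-! ### The main theorem. -/

theorem theorem5p1 {S A Ω : Type*} [MeasurableSpace S] [MeasurableSpace A] [MeasurableSpace Ω]
    {d : ℕ} {Θ : Set (EuclideanSpace ℝ (Fin d))} (hΘ : IsOpen Θ)
    {ν : Measure A} [SigmaFinite ν]
    (M : MDP S A) (pol : Policy S Θ ν) (e : EstimatorKind)
    (hreg : pol.LogRegular)
    (D : ℝ) (hD : 1 ≤ D) (hchi : pol.ChiSqBounded M D)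
    (μ : Measure Ω) [IsProbabilityMeasure μ]
    (k w N : ℕ) (hk : 1 ≤ k) (hw : 1 ≤ w)
    (θs : ℕ → Ω → Θ) (τs : ℕ → Ω → Fin N → M.Traj) (hist : IsHistory pol M μ k θs τs)
    (target : Ω → Θ) (htarget : Measurable target)
    (hindep : Indep (MeasurableSpace.comap target inferInstance) (historySigma θs τs k) μ)
    (δ : ℝ) (hδ₀ : 0 < δ) (hδ₁ : δ < 1)
    (hN : 4 * (d * Real.log 6 + Real.log (1 / δ)) / (3 * D) ≤ N)
    (lam α : ℕ → ℝ)
    (hlam : ∀ i ∈ Finset.Icc (winStart w k) k,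
      lam i = √(4 * (d * Real.log 6 + Real.log (1 / δ)) / (3 * D * N * winSize w k)))
    (hα : ∀ i ∈ Finset.Icc (winStart w k) k, α i = 1 / (winSize w k : ℝ)) :
    (∀ θ ∈ Θ, DifferentiableAt ℝ (pol.J M) θ) ∧
    BddAbove (pol.estimNorms M e) ∧
    ENNReal.ofReal (1 - δ) ≤
      μ {ω | ‖pol.mpm M e w k α lam (fun i => θs i ω) (fun i => τs i ω) (target ω)
            - gradient (pol.J M) (target ω)‖
          ≤ 8 * sSup (pol.estimNorms M e) *
              √(D * (d * Real.log 6 + Real.log (1 / δ)) / (N * winSize w k))} := by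
  have hgrad : ∀ θ ∈ Θ, HasGradientAt (pol.J M) (∫ τ, pol.singleEstim M e θ τ ∂pol.trajLaw M θ) θ :=
    fun θ hθ => pol.hasGradientAt_J M hΘ hreg e hθ
  have hbdd := pol.bddAbove_estimNorms hreg M e
  refine ⟨fun θ hθ => (hgrad θ hθ).differentiableAt, hbdd, ?_⟩
  have hG : ∀ θ ∈ Θ, ∀ τ, ‖pol.singleEstim M e θ τ‖ ≤ sSup (pol.estimNorms M e) :=
    fun θ hθ τ => le_csSup hbdd ⟨θ, hθ, τ, rfl⟩
  have hG0 : 0 ≤ sSup (pol.estimNorms M e) :=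
    Real.sSup_nonneg (by rintro x ⟨θ, hθ, τ, rfl⟩; exact norm_nonneg _)
  -- The scale `l / G` needs `G > 0`. If `G = 0`, every single-trajectory estimator vanishes, hence
  -- so do the gradient and the error.
  rcases hG0.eq_or_lt with hG0 | hG0
  · have hzero : ∀ θ ∈ Θ, ∀ τ, pol.singleEstim M e θ τ = 0 := fun θ hθ τ =>
      norm_le_zero_iff.1 ((hG θ hθ τ).trans_eq hG0.symm)
    have hall : ∀ ω, pol.mpm M e w k α lam (fun i => θs i ω) (fun i => τs i ω) (target ω)
        - gradient (pol.J M) (target ω) = 0 := fun ω => by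
      rw [(hgrad _ (target ω).2).gradient]
      simp [Policy.mpm, hzero _ (target ω).2]
    simp [hall, ← hG0, hδ₀.le]
  have hL0 : 0 < d * Real.log 6 + Real.log (1 / δ) := by
    have h1 : 0 < Real.log (1 / δ) := Real.log_pos (by rw [lt_div_iff₀ hδ₀]; linarith)
    have h2 : 0 ≤ (d : ℝ) * Real.log 6 :=
      mul_nonneg (Nat.cast_nonneg d) (Real.log_nonneg (by norm_num))
    linarith
  have hD0 : 0 < D := by linarith
  have hN0 : 0 < (N : ℝ) := lt_of_lt_of_le (by positivity) hN
  have hw0 : 1 ≤ winSize w k := le_min hw hk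
  have hw1 : (1 : ℝ) ≤ winSize w k := by exact_mod_cast hw0
  -- The batch-size condition is what makes `λ` a genuine mixing weight.
  have hl1 : √(4 * (d * Real.log 6 + Real.log (1 / δ)) / (3 * D * N * winSize w k)) ≤ 1 := by
    rw [Real.sqrt_le_one, div_le_one (by positivity)]
    rw [div_le_iff₀ (by positivity)] at hN
    calc _ ≤ (N : ℝ) * (3 * D) := hN
      _ ≤ (N : ℝ) * (3 * D) * winSize w k := le_mul_of_one_le_right (by positivity) hw1
      _ = _ := by ring
  classical
  -- Measurability is known only for indices in `1, …, k`; all others are redirected to `1`, so that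
  -- the whole sequence is measurable with respect to the history.
  let c : ℕ → ℕ := fun i => if i ∈ Finset.Icc 1 k then i else 1
  have hcmem : ∀ i, c i ∈ Finset.Icc 1 k := by
    intro i
    by_cases h : i ∈ Finset.Icc 1 k
    · simpa only [c, if_pos h] using h
    · simpa only [c, if_neg h] using Finset.mem_Icc.2 ⟨le_rfl, hk⟩
  let H : Ω → ℕ → Θ × (Fin N → M.Traj) := fun ω i => (θs (c i) ω, τs (c i) ω)
  have hHm : Measurable H := measurable_pi_iff.2 fun i =>
    (hist.measurable_param _ (hcmem i)).prodMk (hist.measurable_batch _ (hcmem i))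
  have hHhist : Measurable[historySigma θs τs k] H := by
    refine @measurable_pi_lambda _ _ _ (historySigma θs τs k) _ _ fun i => Measurable.prodMk ?_ ?_
    · exact measurable_iff_comap_le.2
        ((le_iSup₂ (f := fun l (_ : l ∈ Finset.Icc 1 k) =>
          MeasurableSpace.comap (θs l) inferInstance) (c i) (hcmem i)).trans le_sup_left)
    · exact measurable_iff_comap_le.2
        ((le_iSup₂ (f := fun l (_ : l ∈ Finset.Icc 1 k) =>
          MeasurableSpace.comap (τs l) inferInstance) (c i) (hcmem i)).trans le_sup_right)
  have hind : IndepFun target H μ := (IndepFun_iff_Indep _ _ _).2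
    (indep_of_indep_of_le_right hindep hHhist.comap_le)
  have hmpm : ∀ ω (θ : EuclideanSpace ℝ (Fin d)),
      pol.mpm M e w k α lam (fun i => (H ω i).1) (fun i => (H ω i).2) θ =
        pol.mpm M e w k α lam (fun i => θs i ω) (fun i => τs i ω) θ := fun ω θ =>
    pol.mpm_congr M e α lam (fun i hi => by simp only [H, c, if_pos hi, and_self]) θ
  have hB : MeasurableSet {x : Θ × (ℕ → Θ × (Fin N → M.Traj)) |
      8 * sSup (pol.estimNorms M e) *
        √(D * (d * Real.log 6 + Real.log (1 / δ)) / (N * winSize w k)) <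
      ‖pol.mpm M e w k α lam (fun i => (x.2 i).1) (fun i => (x.2 i).2) x.1
        - gradient (pol.J M) x.1‖} :=
    measurableSet_lt measurable_const ((Policy.measurable_mpm hΘ hreg e w k α lam).sub
      ((measurable_gradient (pol.J M)).comp (measurable_subtype_coe.comp measurable_fst))).norm
  have hbad := measure_le_of_indepFun htarget hHm hind hB (c := ENNReal.ofReal δ) fun θ => by
    simp only [Set.mem_ofPred_eq, hmpm]
    exact hist.measure_mpm_deviation_le hΘ hreg e hD hchi θ.2 hG0 (hG θ θ.2) hδ₀ hδ₁
      (by exact_mod_cast hN0) hw0 rfl hl1 hlam hα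
  simp only [Set.mem_ofPred_eq, hmpm] at hbad
  rw [ENNReal.ofReal_sub _ hδ₀.le, ENNReal.ofReal_one, tsub_le_iff_right]
  -- Subadditivity over the good and bad events replaces taking complements.
  calc (1 : ENNReal) = μ Set.univ := measure_univ.symm
    _ ≤ μ ({ω | ‖pol.mpm M e w k α lam (fun i => θs i ω) (fun i => τs i ω) (target ω)
            - gradient (pol.J M) (target ω)‖
          ≤ 8 * sSup (pol.estimNorms M e) *
              √(D * (d * Real.log 6 + Real.log (1 / δ)) / (N * winSize w k))} ∪
        {ω | 8 * sSup (pol.estimNorms M e) *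
              √(D * (d * Real.log 6 + Real.log (1 / δ)) / (N * winSize w k)) <
          ‖pol.mpm M e w k α lam (fun i => θs i ω) (fun i => τs i ω) (target ω)
            - gradient (pol.J M) (target ω)‖}) :=
        measure_mono fun ω _ => by
          rw [Set.mem_union, Set.mem_ofPred_eq, Set.mem_ofPred_eq]
          exact le_or_gt _ _
    _ ≤ _ := (measure_union_le _ _).trans (by gcongr)
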